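/- For $n\ge 2$ the $n$-dimensional locally twisted cube $LTQ_n$ is the graph on the set $\{0,1\}^n$ of binary sequences defined recursively as follows. $LTQ_2$ is the $4$-cycle in which two sequences are adjacent if and only if they differ in exactly one bit. For $n\ge 3$, $LTQ_n$ consists of two disjoint copies of $LTQ_{n-1}$, the labels of one prefixed with $0$ and those of the other prefixed with $1$, together with the edges that join each $0x_2x_3\cdots x_n$ to $1(x_2+x_n)x_3\cdots x_n$, where $+$ is addition modulo $2$. The crossing number $cr(G)$ of a graph $G$ is the minimum number of pairwise intersections of edges (not counting common end vertices) in a drawing of $G$ in the plane, where a drawing represents the vertices by distinct points and each edge by a simple arc joining its end vertices and passing through no other vertex. **Theorem.** For every integer $n\ge 6$, $$cr(LTQ_n)\le \frac{265}{6}\,4^{n-4}-\left(n^2+\frac{15+(-1)^{n-1}}{6}\right)2^{n-3}.$$ -/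

import Mathlib

/-- The `n`-dimensional hypercube: vertices are the 0-1 sequences of length `n`, and two of them are
adjacent when they differ in exactly one bit. -/
def hypercubeGraph (n : ℕ) : SimpleGraph (Fin n → ZMod 2) where
  Adj x y := hammingDist x y = 1
  symm := ⟨fun x y h => by rwa [hammingDist_comm]⟩
  loopless := ⟨fun x h => by simp at h⟩

/-- For a sequence `x = 0 x₂ x₃ … xₙ` with `n = m + 3`, the sequence `1 (x₂ + xₙ) x₃ … xₙ`
(the bit `xᵢ` is `x (i - 1)`, and the addition is modulo 2). -/
def twistedPartner {m : ℕ} (x : Fin (m + 3) → ZMod 2) : Fin (m + 3) → ZMod 2 :=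
  Function.update (Function.update x 0 1) 1 (x 1 + x (Fin.last (m + 2)))

/-- Two copies of a graph `G`, with the labels of one prefixed by `0` and those of the other by `1`,
where each `x = 0 x₂ x₃ … xₙ` is moreover joined to `1 (x₂ + xₙ) x₃ … xₙ`. -/
def locallyTwistedStep {m : ℕ} (G : SimpleGraph (Fin (m + 2) → ZMod 2)) :
    SimpleGraph (Fin (m + 3) → ZMod 2) where
  Adj x y :=
    (x 0 = y 0 ∧ G.Adj (Fin.tail x) (Fin.tail y)) ∨
    (x 0 = 0 ∧ y = twistedPartner x) ∨
    (y 0 = 0 ∧ x = twistedPartner y)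
  symm := ⟨by
    rintro x y (⟨h, h'⟩ | h | h)
    · exact Or.inl ⟨h.symm, h'.symm⟩
    · exact Or.inr (Or.inr h)
    · exact Or.inr (Or.inl h)⟩
  loopless := ⟨by
    have key : ∀ x : Fin (m + 3) → ZMod 2, ¬ (x 0 = 0 ∧ x = twistedPartner x) := by
      rintro x ⟨h0, h⟩
      have h1 := congrFun h 0
      rw [h0] at h1
      simp [twistedPartner] at h1
    rintro x (⟨-, h⟩ | h | h)
    · exact G.loopless.irrefl _ h
    · exact key x h
    · exact key x h⟩

/-- The locally twisted cube `LTQₙ`, for `n ≥ 2`. (The cases `n = 0, 1` are conventional.) -/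
def LTQ : (n : ℕ) → SimpleGraph (Fin n → ZMod 2)
  | 0 => hypercubeGraph 0
  | 1 => hypercubeGraph 1
  | 2 => hypercubeGraph 2
  | m + 3 => locallyTwistedStep (LTQ (m + 2))

/-- A drawing of a graph in the plane: distinct vertices are distinct points, and every edge is a
simple arc that joins its two end vertices and passes through no vertex in its interior. -/
structure PlaneDrawing {V : Type*} (G : SimpleGraph V) where
  /-- The position of each vertex. -/
  point : V → ℝ × ℝ
  point_injective : Function.Injective point
  /-- A parametrization of the arc that represents each edge. -/
  arc : G.edgeSet → unitInterval → ℝ × ℝ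
  arc_continuous : ∀ e, Continuous (arc e)
  arc_injective : ∀ e, Function.Injective (arc e)
  arc_ends : ∀ e, s(arc e 0, arc e 1) = Sym2.map point e.1
  arc_avoids : ∀ e, ∀ t ∈ Set.Ioo (0 : unitInterval) 1, ∀ v, arc e t ≠ point v

namespace PlaneDrawing

variable {V : Type*} {G : SimpleGraph V}

/-- The arc of an edge without its two ends. -/
def openArc (D : PlaneDrawing G) (e : G.edgeSet) : Set (ℝ × ℝ) :=
  D.arc e '' Set.Ioo 0 1

/-- The crossings of a drawing: an unordered pair of distinct edges together with a point at which
the two edges meet, other than at a common end. Every pairwise intersection counts, so a point where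
three edges meet counts three times, and a point where two edges merely touch counts as well. -/
def crossings (D : PlaneDrawing G) : Set (Sym2 G.edgeSet × (ℝ × ℝ)) :=
  {c | ¬ c.1.IsDiag ∧ ∀ e ∈ c.1, c.2 ∈ D.openArc e}

end PlaneDrawing

/-- The crossing number of a graph: the minimum number of crossings in a drawing of the graph in the
plane (`⊤` if there is no drawing with finitely many crossings). -/
noncomputable def crossingNumber {V : Type*} (G : SimpleGraph V) : ℕ∞ :=
  ⨅ D : PlaneDrawing G, D.crossings.encard

/-!
Drop the last bit of a vertex and, where it is `1`, replace the other bits by their prefix sums.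
Both halves of the locally twisted cube become hypercubes of dimension `m = n - 1`, joined by the
edges from `x` to `prefixSum x`.

Place the vertices on a line and draw every edge as a semicircle above or below it, so that only
interleaving edges on the same side cross. To pass from `m` to `m + 1`, replace each vertex by two
consecutive copies, numbered `0` and `1`, each edge by two parallel ones, and join the copies of a
vertex. Every crossing then yields at most four. A new crossing comes from two edges with a common
end on the same side, or from an edge whose two copies join ends with equal numbers. If the edges at
each vertex are divided evenly between the sides, which a suitable choice of sides for the new edges
preserves, there are at most `⌊m ^ 2 / 4⌋ * 2 ^ (m + 1)` crossings of the first kind.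

Numbering the copies by the parity of the bits avoids the second kind within the halves, but an edge
from `x` to `prefixSum x` would give such a crossing whenever `prefixSum x` has odd parity.
Therefore, where the first four terms of `prefixSum x` have odd sum, this edge is drawn as two
semicircles on different sides of the line, and the numbering at the point where they meet is
reversed. This leaves only the edges for which the other terms have odd sum: none for `m = 4` and
half of them for `m ≥ 5`. The recursion starts from a drawing with `m = 4` and 68 crossings, found
by computer.
-/

/-- A drawing of a graph with its vertices on a horizontal line, the spine, in which every edge is a
semicircle above or below the spine. -/
structure SpineDrawing {W : Type*} (H : SimpleGraph W) where
  /-- The position of each vertex on the spine. -/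
  pos : W → ℕ
  pos_injective : Function.Injective pos
  /-- Whether the edge that joins two vertices is drawn above the spine. -/
  side : W → W → Bool
  side_comm : ∀ a b, side a b = side b a

section Curves

open Set

lemma path_trans_injective {X : Type*} [TopologicalSpace X] {x y z : X} {γ : Path x y}
    {γ' : Path y z} (hγ : Function.Injective γ) (hγ' : Function.Injective γ')
    (hmeet : ∀ s t, γ s = γ' t → γ s = y) : Function.Injective (γ.trans γ') := by
  have ends : ∀ s t, γ s = γ' t → s = 1 ∧ t = 0 := fun s t h =>
    ⟨hγ ((hmeet s t h).trans γ.target.symm),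
      hγ' ((h.symm.trans (hmeet s t h)).trans γ'.source.symm)⟩
  intro s t h
  rw [Path.trans_apply, Path.trans_apply] at h
  apply Subtype.ext
  split_ifs at h
  · have := congrArg Subtype.val (hγ h)
    dsimp only at this
    linarith
  · have := congrArg Subtype.val (ends _ _ h).2
    simp only [Icc.coe_zero] at this
    linarith
  · have := congrArg Subtype.val (ends _ _ h.symm).2
    simp only [Icc.coe_zero] at this
    linarith
  · have := congrArg Subtype.val (hγ' h)
    dsimp only at this
    linarith

lemma path_trans_mem {X : Type*} [TopologicalSpace X] {x y z : X} (γ : Path x y) (γ' : Path y z)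
    {t : unitInterval} (ht : t ∈ Ioo 0 1) :
    (γ.trans γ') t ∈ γ '' Ioo 0 1 ∪ γ' '' Ioo 0 1 ∪ {y} := by
  have ht0 : (0 : ℝ) < t := ht.1
  have ht1 : (t : ℝ) < 1 := ht.2
  rw [Path.trans_apply]
  split_ifs with h
  · rcases h.lt_or_eq with h' | h'
    · exact .inl (.inl ⟨_, ⟨Subtype.mk_lt_mk.2 (by linarith), Subtype.mk_lt_mk.2 (by linarith)⟩,
        rfl⟩)
    · have hmid : (2 : ℝ) * t = 1 := by linarith
      exact .inr ((congrArg γ (Subtype.ext hmid)).trans γ.target)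
  · exact .inl (.inr ⟨_, ⟨Subtype.mk_lt_mk.2 (by linarith), Subtype.mk_lt_mk.2 (by linarith)⟩,
      rfl⟩)

/-- By the altitude theorem, the equation says that the semicircles with diameters `[p, q]` and
`[r, s]` have equal height over `x`. -/
lemma eq_or_interleave_of_semicircles_meet {p q r s x : ℝ} (hpq : p < q) (hrs : r < s)
    (hpos : 0 < (x - p) * (q - x)) (hmeet : (x - p) * (q - x) = (x - r) * (s - x)) :
    (p = r ∧ q = s) ∨ (p < r ∧ r < q ∧ q < s) ∨ (r < p ∧ p < s ∧ s < q) := by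
  have between : ∀ {a b : ℝ}, a < b → 0 < (x - a) * (b - x) → a < x ∧ x < b := by
    intro a b hab h
    rcases pos_and_pos_or_neg_and_neg_of_mul_pos h with h | h
    · exact ⟨by linarith [h.1], by linarith [h.2]⟩
    · linarith [h.1, h.2]
  obtain ⟨hp, hq⟩ := between hpq hpos
  obtain ⟨hr, hs⟩ := between hrs (hmeet ▸ hpos)
  rcases lt_trichotomy p r with hpr | rfl | hrp
  · refine .inr (.inl ⟨hpr, hr.trans hq, ?_⟩)
    by_contra! hsq
    nlinarith
  · exact .inl ⟨rfl, by linarith [mul_left_cancel₀ (sub_pos.2 hp).ne' hmeet]⟩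
  · refine .inr (.inr ⟨hrp, hp.trans hs, ?_⟩)
    by_contra! hqs
    nlinarith

end Curves

namespace SpineDrawing

open Set

variable {W : Type*} {H : SimpleGraph W} {D : SpineDrawing H} {a b c d : W} {z w : ℝ × ℝ}

/-- The point of the plane at which a vertex is placed. -/
def spinePoint (D : SpineDrawing H) (a : W) : ℝ × ℝ := (D.pos a, 0)

/-- The sign of the half-plane that contains the edge between two vertices. -/
def sign (D : SpineDrawing H) (a b : W) : ℝ := if D.side a b then 1 else -1

/-- The open semicircle that represents the edge between two vertices. -/
def openBow (D : SpineDrawing H) (a b : W) : Set (ℝ × ℝ) :=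
  {z | 0 < D.sign a b * z.2 ∧ z.2 ^ 2 = (z.1 - D.pos a) * (D.pos b - z.1)}

lemma pos_cast_injective (D : SpineDrawing H) : Function.Injective fun a => (D.pos a : ℝ) :=
  Nat.cast_injective.comp D.pos_injective

lemma spinePoint_injective (D : SpineDrawing H) : Function.Injective D.spinePoint :=
  fun _ _ h => D.pos_cast_injective (congrArg Prod.fst h)

lemma sign_ne_zero (D : SpineDrawing H) (a b : W) : D.sign a b ≠ 0 := by
  unfold sign; split_ifs <;> norm_num

lemma sign_mul_self (D : SpineDrawing H) (a b : W) : D.sign a b * D.sign a b = 1 := by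
  unfold sign; split_ifs <;> norm_num

lemma openBow_comm (D : SpineDrawing H) (a b : W) : D.openBow a b = D.openBow b a := by
  ext z
  simp only [openBow, sign, D.side_comm a b, mem_ofPred_eq]
  rw [show (z.1 - D.pos a) * (D.pos b - z.1) = (z.1 - D.pos b) * (D.pos a - z.1) by ring]

lemma snd_ne_zero_of_mem_openBow (hz : z ∈ D.openBow a b) : z.2 ≠ 0 :=
  right_ne_zero_of_mul hz.1.ne'

lemma spinePoint_notMem_openBow : D.spinePoint c ∉ D.openBow a b :=
  fun h => snd_ne_zero_of_mem_openBow h rfl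

lemma side_eq_of_mem_openBow (hz : z ∈ D.openBow a b) (hz' : z ∈ D.openBow c d) :
    D.side a b = D.side c d := by
  have h := hz.1
  have h' := hz'.1
  unfold sign at h h'
  cases hab : D.side a b <;> cases hcd : D.side c d <;> simp [hab, hcd] at h h' ⊢ <;> linarith

lemma eq_or_interleave_of_mem_openBow (hz : z ∈ D.openBow a b) (hz' : z ∈ D.openBow c d)
    (hab : D.pos a < D.pos b) (hcd : D.pos c < D.pos d) :
    (a = c ∧ b = d) ∨ (D.pos a < D.pos c ∧ D.pos c < D.pos b ∧ D.pos b < D.pos d) ∨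
      (D.pos c < D.pos a ∧ D.pos a < D.pos d ∧ D.pos d < D.pos b) := by
  have hpos : 0 < (z.1 - D.pos a) * (D.pos b - z.1) :=
    hz.2 ▸ sq_pos_of_ne_zero (snd_ne_zero_of_mem_openBow hz)
  have := eq_or_interleave_of_semicircles_meet (Nat.cast_lt.2 hab) (Nat.cast_lt.2 hcd) hpos
    (hz.2.symm.trans hz'.2)
  simpa only [Nat.cast_inj, Nat.cast_lt, D.pos_injective.eq_iff] using this

lemma eq_of_mem_openBow (hz : z ∈ D.openBow a b) (hz' : z ∈ D.openBow c d)
    (hw : w ∈ D.openBow a b) (hw' : w ∈ D.openBow c d) (hac : D.pos a < D.pos c)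
    (hbd : D.pos b < D.pos d) : z = w := by
  have hac : (D.pos a : ℝ) < D.pos c := Nat.cast_lt.2 hac
  have hbd : (D.pos b : ℝ) < D.pos d := Nat.cast_lt.2 hbd
  have hfst : z.1 = w.1 := by
    have ez := hz.2.symm.trans hz'.2
    have ew := hw.2.symm.trans hw'.2
    have : (z.1 - w.1) * ((D.pos c + D.pos d : ℝ) - (D.pos a + D.pos b)) = 0 := by linarith
    rcases mul_eq_zero.1 this with h | h <;> linarith
  have hsq : (D.sign a b * z.2) ^ 2 = (D.sign a b * w.2) ^ 2 := by
    rw [mul_pow, mul_pow, hz.2, hw.2, hfst]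
  have hsnd : D.sign a b * z.2 = D.sign a b * w.2 :=
    (pow_left_inj₀ hz.1.le hw.1.le two_ne_zero).1 hsq
  exact Prod.ext hfst (mul_left_cancel₀ (D.sign_ne_zero a b) hsnd)

/-- The semicircle between two vertices, parametrized by the projection to the spine. -/
noncomputable def bow (D : SpineDrawing H) (a b : W) : Path (D.spinePoint a) (D.spinePoint b) where
  toFun t := (D.pos a + t * (D.pos b - D.pos a),
    D.sign a b * (|(D.pos b : ℝ) - D.pos a| * √(t * (1 - t))))
  continuous_toFun := by fun_prop
  source' := by simp [spinePoint]
  target' := by simp [spinePoint]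

lemma bow_injective (hab : a ≠ b) : Function.Injective (D.bow a b) := by
  intro s t h
  have h : (D.pos a + s * (D.pos b - D.pos a) : ℝ) = D.pos a + t * (D.pos b - D.pos a) :=
    congrArg Prod.fst h
  exact Subtype.ext
    (mul_right_cancel₀ (sub_ne_zero.2 (D.pos_cast_injective.ne hab.symm)) (add_left_cancel h))

lemma bow_mem_openBow (hab : a ≠ b) {t : unitInterval} (ht : t ∈ Ioo 0 1) :
    D.bow a b t ∈ D.openBow a b := by
  have hdiam : 0 < |(D.pos b : ℝ) - D.pos a| :=
    abs_pos.2 (sub_ne_zero.2 (D.pos_cast_injective.ne hab.symm))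
  have hpos : 0 < (t : ℝ) * (1 - t) := mul_pos ht.1 (sub_pos.2 ht.2)
  constructor
  · change 0 < D.sign a b * (D.sign a b * _)
    rw [← mul_assoc, sign_mul_self, one_mul]
    exact mul_pos hdiam (Real.sqrt_pos.2 hpos)
  · change (D.sign a b * _) ^ 2 = (D.pos a + t * (D.pos b - D.pos a) - D.pos a : ℝ) *
      (D.pos b - (D.pos a + t * (D.pos b - D.pos a)))
    rw [mul_pow, mul_pow, sq_abs, Real.sq_sqrt hpos.le, pow_two, sign_mul_self]
    ring

lemma bow_eq_end_or_mem (hab : a ≠ b) (t : unitInterval) :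
    D.bow a b t = D.spinePoint a ∨ D.bow a b t = D.spinePoint b ∨ D.bow a b t ∈ D.openBow a b := by
  rcases eq_or_ne t 0 with rfl | h0
  · exact .inl (D.bow a b).source
  rcases eq_or_ne t 1 with rfl | h1
  · exact .inr (.inl (D.bow a b).target)
  exact .inr (.inr (bow_mem_openBow hab ⟨unitInterval.pos_iff_ne_zero.2 h0,
    unitInterval.lt_one_iff_ne_one.2 h1⟩))

lemma bow_trans_bow_injective (hab : a ≠ b) (had : a ≠ d) (hdb : d ≠ b)
    (hside : D.side a d ≠ D.side d b) : Function.Injective ((D.bow a d).trans (D.bow d b)) := by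
  refine path_trans_injective (bow_injective had) (bow_injective hdb) fun s t h => ?_
  have habp := D.spinePoint_injective.ne hab
  have hadp := D.spinePoint_injective.ne had
  rcases bow_eq_end_or_mem (D := D) had s with hs | hs | hs <;>
    rcases bow_eq_end_or_mem (D := D) hdb t with ht | ht | ht
  · exact absurd (hs.symm.trans (h.trans ht)) hadp
  · exact absurd (hs.symm.trans (h.trans ht)) habp
  · exact absurd (hs ▸ h ▸ ht) spinePoint_notMem_openBow
  · exact hs
  · exact hs
  · exact hs
  · exact h.trans ht
  · exact absurd (ht ▸ h ▸ hs) spinePoint_notMem_openBow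
  · exact absurd (side_eq_of_mem_openBow hs (h ▸ ht)) hside

end SpineDrawing

namespace SpineDrawing

open Set
open scoped Finset

variable {V W : Type*} {G : SimpleGraph V} {H : SimpleGraph W} {D : SpineDrawing H} {ι : V → W}
  {e e' : Sym2 V} {f : Sym2 W} {u v : V} {a b c d d' : W} {z : ℝ × ℝ}

/-- When the vertices of a graph are placed by `ι` at vertices of `H`, the pair `e` of distinct
vertices is joined by a path of length two in `H` with middle vertex `d`, which no vertex
occupies. -/
def BendsAt (H : SimpleGraph W) (ι : V → W) (e : Sym2 V) (d : W) : Prop :=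
  d ∉ range ι ∧ ¬ e.IsDiag ∧ ∀ u ∈ e, H.Adj (ι u) d

/-- When the vertices of a graph are placed by `ι` at vertices of `H`, the pair `f` is a possible
part of the edge `e`: it either is `e` itself or is one half of a path of length two. -/
def Carries (H : SimpleGraph W) (ι : V → W) (e : Sym2 V) (f : Sym2 W) : Prop :=
  f = e.map ι ∨ ∃ u ∈ e, ∃ d, BendsAt H ι e d ∧ f = s(ι u, d)

/-- The drawing `D` yields a drawing of the graph `G`: the vertices of `G` are placed at vertices of
`D`, and each edge of `G` follows either one edge of `D` or two that lie on different sides of the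
spine; no two edges of `G` have the same middle vertex. -/
structure Realizes (D : SpineDrawing H) (G : SimpleGraph V) (ι : V → W) : Prop where
  injective : Function.Injective ι
  adj_or_bend : ∀ {u v}, G.Adj u v → H.Adj (ι u) (ι v) ∨
    ∃ d ∉ range ι, H.Adj (ι u) d ∧ H.Adj d (ι v) ∧ D.side (ι u) d ≠ D.side d (ι v)
  bend_unique : ∀ {e e' d}, BendsAt H ι e d → BendsAt H ι e' d → e = e'

/-- The points of the plane through which an edge may pass between its ends. -/
def track (D : SpineDrawing H) (ι : V → W) (e : Sym2 V) : Set (ℝ × ℝ) :=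
  {z | (∃ a b, H.Adj a b ∧ Carries H ι e s(a, b) ∧ z ∈ D.openBow a b) ∨
    ∃ d, BendsAt H ι e d ∧ z = D.spinePoint d}

lemma map_ne_of_notMem_range (hd : d ∉ range ι) : e.map ι ≠ s(c, d) := by
  intro h
  obtain ⟨v, -, hv⟩ := Sym2.mem_map.1 (h ▸ Sym2.mem_mk_right c d)
  exact hd ⟨v, hv⟩

lemma eq_of_mk_eq_of_notMem_range (hd : d ∉ range ι) (h : s(ι u, d) = s(ι v, d')) : d = d' := by
  rcases Sym2.eq_iff.1 h with ⟨-, h⟩ | ⟨-, h⟩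
  · exact h
  · exact absurd ⟨v, h.symm⟩ hd

lemma Realizes.carries_unique (h : D.Realizes G ι) (he : Carries H ι e f)
    (he' : Carries H ι e' f) : e = e' := by
  rcases he with rfl | ⟨u, -, d, hd, rfl⟩ <;> rcases he' with hf | ⟨u', -, d', hd', hf⟩
  · exact Sym2.map.injective h.injective hf
  · exact absurd hf (map_ne_of_notMem_range hd'.1)
  · exact absurd hf.symm (map_ne_of_notMem_range hd.1)
  · obtain rfl := eq_of_mk_eq_of_notMem_range hd.1 hf
    exact h.bend_unique hd hd'

lemma Realizes.exists_arc (h : D.Realizes G ι) (huv : G.Adj u v) :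
    ∃ γ : Path (D.spinePoint (ι u)) (D.spinePoint (ι v)), Function.Injective γ ∧
      ∀ t ∈ Ioo 0 1, γ t ∈ D.track ι s(u, v) := by
  have hne := h.injective.ne huv.ne
  rcases h.adj_or_bend huv with hadj | ⟨d, hd, hud, hdv, hside⟩
  · exact ⟨D.bow _ _, bow_injective hne, fun t ht =>
      .inl ⟨_, _, hadj, .inl rfl, bow_mem_openBow hne ht⟩⟩
  · have hbend : BendsAt H ι s(u, v) d := by
      refine ⟨hd, Sym2.mk_isDiag_iff.not.2 huv.ne, fun w hw => ?_⟩
      rcases Sym2.mem_iff.1 hw with rfl | rfl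
      exacts [hud, hdv.symm]
    refine ⟨(D.bow _ d).trans (D.bow d _), bow_trans_bow_injective hne hud.ne hdv.ne hside,
      fun t ht => ?_⟩
    rcases path_trans_mem (D.bow (ι u) d) (D.bow d (ι v)) ht with
      (⟨s, hs, hst⟩ | ⟨s, hs, hst⟩) | hst
    · exact .inl ⟨_, _, hud, .inr ⟨u, Sym2.mem_mk_left _ _, d, hbend, rfl⟩,
        hst ▸ bow_mem_openBow hud.ne hs⟩
    · exact .inl ⟨_, _, hdv, .inr ⟨v, Sym2.mem_mk_right _ _, d, hbend, Sym2.eq_swap⟩,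
        hst ▸ bow_mem_openBow hdv.ne hs⟩
    · exact .inr ⟨d, hbend, hst⟩

lemma spinePoint_notMem_track (v : V) : D.spinePoint (ι v) ∉ D.track ι e := by
  rintro (⟨a, b, -, -, hz⟩ | ⟨d, hd, hz⟩)
  · exact spinePoint_notMem_openBow hz
  · exact hd.1 ⟨v, D.spinePoint_injective hz⟩

theorem Realizes.exists_planeDrawing (h : D.Realizes G ι) :
    ∃ P : PlaneDrawing G, ∀ e, P.openArc e ⊆ D.track ι e := by
  have arc (e : G.edgeSet) : ∃ γ : unitInterval → ℝ × ℝ, Continuous γ ∧ Function.Injective γ ∧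
      s(γ 0, γ 1) = Sym2.map (D.spinePoint ∘ ι) e ∧ ∀ t ∈ Ioo 0 1, γ t ∈ D.track ι e := by
    obtain ⟨⟨u, v⟩, he⟩ := e
    obtain ⟨γ, hγ, htrack⟩ := h.exists_arc he
    exact ⟨γ, γ.continuous, hγ, by simp [γ.source, γ.target], htrack⟩
  choose γ hcont hinj hends htrack using arc
  refine ⟨⟨D.spinePoint ∘ ι, D.spinePoint_injective.comp h.injective, γ, hcont, hinj, hends,
    fun e t ht v hv => spinePoint_notMem_track v (hv ▸ htrack e t ht)⟩, fun e => ?_⟩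
  rintro _ ⟨t, ht, rfl⟩
  exact htrack e t ht

open scoped Classical in
/-- The pairs of edges on the same side of the spine that interleave: `(a, b, c, d)` stands for the
edges `ab` and `cd`, where `a < c < b < d` on the spine. -/
noncomputable def interleavings [Fintype W] (D : SpineDrawing H) : Finset (W × W × W × W) :=
  {q | H.Adj q.1 q.2.1 ∧ H.Adj q.2.2.1 q.2.2.2 ∧ D.side q.1 q.2.1 = D.side q.2.2.1 q.2.2.2 ∧
    D.pos q.1 < D.pos q.2.2.1 ∧ D.pos q.2.2.1 < D.pos q.2.1 ∧ D.pos q.2.1 < D.pos q.2.2.2}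

lemma mem_interleavings [Fintype W] : (a, b, c, d) ∈ D.interleavings ↔
    H.Adj a b ∧ H.Adj c d ∧ D.side a b = D.side c d ∧
      D.pos a < D.pos c ∧ D.pos c < D.pos b ∧ D.pos b < D.pos d := by
  simp only [interleavings, Finset.mem_filter, Finset.mem_univ, true_and]

lemma exists_openBow_of_mem_track (hz : z ∈ D.track ι e) (hz2 : z.2 ≠ 0) :
    ∃ a b, H.Adj a b ∧ Carries H ι e s(a, b) ∧ z ∈ D.openBow a b ∧ D.pos a < D.pos b := by
  rcases hz with ⟨a, b, hab, hcar, hbow⟩ | ⟨d, -, rfl⟩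
  · rcases lt_or_gt_of_ne (D.pos_injective.ne hab.ne) with hlt | hlt
    · exact ⟨a, b, hab, hcar, hbow, hlt⟩
    · exact ⟨b, a, hab.symm, Sym2.eq_swap ▸ hcar, D.openBow_comm a b ▸ hbow, hlt⟩
  · exact absurd rfl hz2

lemma Realizes.eq_of_mem_track (h : D.Realizes G ι) (hz : z ∈ D.track ι e)
    (hz' : z ∈ D.track ι e') (hz2 : z.2 = 0) : e = e' := by
  rcases hz with ⟨a, b, -, -, hbow⟩ | ⟨d, hd, rfl⟩
  · exact absurd hz2 (snd_ne_zero_of_mem_openBow hbow)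
  rcases hz' with ⟨a, b, -, -, hbow⟩ | ⟨d', hd', hdd'⟩
  · exact absurd hbow spinePoint_notMem_openBow
  · exact h.bend_unique hd (D.spinePoint_injective hdd' ▸ hd')

lemma Realizes.exists_interleaving [Fintype W] (h : D.Realizes G ι) {ε : Sym2 (Sym2 V)}
    (hε : ¬ ε.IsDiag) (hz : ∀ e ∈ ε, z ∈ D.track ι e) :
    ∃ a b c d, (a, b, c, d) ∈ D.interleavings ∧
      (∃ e e', ε = s(e, e') ∧ Carries H ι e s(a, b) ∧ Carries H ι e' s(c, d)) ∧
      z ∈ D.openBow a b ∧ z ∈ D.openBow c d := by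
  obtain ⟨e, e'⟩ := ε
  have he := hz e (Sym2.mem_mk_left _ _)
  have he' := hz e' (Sym2.mem_mk_right _ _)
  have hne : e ≠ e' := Sym2.mk_isDiag_iff.not.1 hε
  have hz2 : z.2 ≠ 0 := fun h0 => hne (h.eq_of_mem_track he he' h0)
  obtain ⟨a, b, hab, hcar, hbow, hlt⟩ := exists_openBow_of_mem_track he hz2
  obtain ⟨c, d, hcd, hcar', hbow', hlt'⟩ := exists_openBow_of_mem_track he' hz2
  have hside := side_eq_of_mem_openBow hbow hbow'
  rcases eq_or_interleave_of_mem_openBow hbow hbow' hlt hlt' with ⟨rfl, rfl⟩ | hlt | hlt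
  · exact absurd (h.carries_unique hcar hcar') hne
  · exact ⟨a, b, c, d, mem_interleavings.2 ⟨hab, hcd, hside, hlt⟩,
      ⟨e, e', rfl, hcar, hcar'⟩, hbow, hbow'⟩
  · exact ⟨c, d, a, b, mem_interleavings.2 ⟨hcd, hab, hside.symm, hlt⟩,
      ⟨e', e, Sym2.eq_swap, hcar', hcar⟩, hbow', hbow⟩

theorem Realizes.crossingNumber_le [Fintype W] (h : D.Realizes G ι) :
    crossingNumber G ≤ #D.interleavings := by
  obtain ⟨P, hP⟩ := h.exists_planeDrawing
  refine (iInf_le _ P).trans ?_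
  have cross : ∀ x ∈ P.crossings, ∃ q ∈ D.interleavings,
      (∃ e e', x.1.map Subtype.val = s(e, e') ∧ Carries H ι e s(q.1, q.2.1) ∧
        Carries H ι e' s(q.2.2.1, q.2.2.2)) ∧
      x.2 ∈ D.openBow q.1 q.2.1 ∧ x.2 ∈ D.openBow q.2.2.1 q.2.2.2 := by
    rintro x ⟨hdiag, hx⟩
    obtain ⟨a, b, c, d, hq, hcar⟩ := h.exists_interleaving (ε := x.1.map Subtype.val)
      ((Sym2.isDiag_map Subtype.val_injective).not.2 hdiag) (z := x.2) fun e he => by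
        obtain ⟨e, hmem, rfl⟩ := Sym2.mem_map.1 he
        exact hP e (hx e hmem)
    exact ⟨_, hq, hcar⟩
  choose Q hQ hcar hbow hbow' using cross
  rw [← encard_coe_eq_coe_finsetCard]
  refine Function.Embedding.encard_le ⟨fun x => ⟨Q x x.2, hQ x x.2⟩, ?_⟩
  rintro ⟨x, hx⟩ ⟨y, hy⟩ hxy
  have hxy : Q x hx = Q y hy := congrArg Subtype.val hxy
  obtain ⟨-, -, -, hac, -, hbd⟩ := mem_interleavings.1 (hQ x hx)
  have hedges : x.1.map Subtype.val = y.1.map Subtype.val := by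
    obtain ⟨e, f, hef, he, hf⟩ := hcar x hx
    obtain ⟨e', f', hef', he', hf'⟩ := hcar y hy
    rw [← hxy] at he' hf'
    rw [hef, hef', h.carries_unique he he', h.carries_unique hf hf']
  exact Subtype.ext (Prod.ext (Sym2.map.injective Subtype.val_injective hedges)
    (eq_of_mem_openBow (hbow x hx) (hbow' x hx) (hxy ▸ hbow y hy) (hxy ▸ hbow' y hy) hac hbd))

end SpineDrawing

namespace SpineDrawing

open Finset

variable {W W' : Type*} {H : SimpleGraph W} {H' : SimpleGraph W'} {D : SpineDrawing H}
  {D' : SpineDrawing H'} {π : W' → W} {bit : W' → ZMod 2} {β : W → W → ZMod 2}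
  {a b c d w w' x u u' : W'}

/-- `D'` arises from `D` by replacing each vertex by two consecutive ones and each edge by parallel
ones: the vertex `w` of `D'` is the copy with number `bit w` of the vertex `π w` of `D`, and the
ends of an edge have different numbers where the voltage `β` is `1`. The copies of a vertex may be
adjacent. -/
structure IsDoubling (D : SpineDrawing H) (D' : SpineDrawing H') (π : W' → W) (bit : W' → ZMod 2)
    (β : W → W → ZMod 2) : Prop where
  pos_eq : ∀ w, D'.pos w = 2 * D.pos (π w) + (bit w).val
  adj : ∀ {w u}, H'.Adj w u → π w ≠ π u → H.Adj (π w) (π u)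
  side_eq : ∀ {w u}, H'.Adj w u → π w ≠ π u → D'.side w u = D.side (π w) (π u)
  bit_eq : ∀ {w u}, H'.Adj w u → π w ≠ π u → bit u = bit w + β (π w) (π u)

open scoped Classical in
/-- The pairs of edges on the same side of the spine with a common end: `(v, b, d)` stands for the
edges `vb` and `vd`, where `b < d` on the spine. -/
noncomputable def wedges [Fintype W] (D : SpineDrawing H) : Finset (W × W × W) :=
  {q | H.Adj q.1 q.2.1 ∧ H.Adj q.1 q.2.2 ∧ D.side q.1 q.2.1 = D.side q.1 q.2.2 ∧
    D.pos q.2.1 < D.pos q.2.2}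

lemma mem_wedges [Fintype W] {v b d : W} : (v, b, d) ∈ D.wedges ↔
    H.Adj v b ∧ H.Adj v d ∧ D.side v b = D.side v d ∧ D.pos b < D.pos d := by
  simp only [wedges, mem_filter, mem_univ, true_and]

open scoped Classical in
/-- The edges at which the voltage `β` vanishes; their two copies cross each other. -/
noncomputable def twists [Fintype W] (D : SpineDrawing H) (β : W → W → ZMod 2) : Finset (W × W) :=
  {q | H.Adj q.1 q.2 ∧ D.pos q.1 < D.pos q.2 ∧ β q.1 q.2 = 0}

lemma mem_twists [Fintype W] {v b : W} :
    (v, b) ∈ D.twists β ↔ H.Adj v b ∧ D.pos v < D.pos b ∧ β v b = 0 := by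
  simp only [twists, mem_filter, mem_univ, true_and]

/-- The quadruple of ends of the two edges of a wedge, in the order in which `interleavings` lists
the ends of their copies that cross. -/
def wedgeEnds (D : SpineDrawing H) (q : W × W × W) : W × W × W × W :=
  if D.pos q.1 < D.pos q.2.1 then (q.1, q.2.1, q.1, q.2.2)
  else if D.pos q.1 < D.pos q.2.2 then (q.2.1, q.1, q.1, q.2.2)
  else (q.2.1, q.1, q.2.2, q.1)

namespace IsDoubling

lemma pos_lt_or_eq (h : IsDoubling D D' π bit β) (hlt : D'.pos w < D'.pos u) :
    D.pos (π w) < D.pos (π u) ∨ π w = π u := by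
  rw [h.pos_eq, h.pos_eq] at hlt
  have := (bit u).val_lt
  exact (show D.pos (π w) ≤ D.pos (π u) by omega).lt_or_eq.imp_right fun e => D.pos_injective e

lemma bits_of_eq (h : IsDoubling D D' π bit β) (hlt : D'.pos w < D'.pos u) (hπ : π w = π u) :
    bit w = 0 ∧ bit u = 1 := by
  rw [h.pos_eq, h.pos_eq, hπ, Nat.add_lt_add_iff_left] at hlt
  generalize bit w = s at hlt ⊢
  generalize bit u = t at hlt ⊢
  revert s t
  decide

lemma ne_of_between (h : IsDoubling D D' π bit β) (hwx : D'.pos w < D'.pos x)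
    (hxu : D'.pos x < D'.pos u) : π w ≠ π u := by
  intro hπ
  simp only [h.pos_eq, hπ] at hwx hxu
  have := (bit u).val_lt
  omega

lemma edge_ext (h : IsDoubling D D' π bit β) (hadj : H'.Adj w u) (hadj' : H'.Adj w' u')
    (hne : π w ≠ π u) (hw : π w = π w') (hu : π u = π u') (hbit : bit w = bit w' ∨ bit u = bit u') :
    w = w' ∧ u = u' := by
  have ext {w w'} (hπ : π w = π w') (hbit : bit w = bit w') : w = w' :=
    D'.pos_injective (by rw [h.pos_eq, h.pos_eq, hπ, hbit])
  have hbit_u := h.bit_eq hadj hne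
  have hbit_u' := h.bit_eq hadj' (hw ▸ hu ▸ hne)
  rw [← hw, ← hu] at hbit_u'
  rcases hbit with hbit | hbit
  · exact ⟨ext hw hbit, ext hu (by rw [hbit_u, hbit_u', hbit])⟩
  · exact ⟨ext hw (add_right_cancel (by rw [← hbit_u, ← hbit_u', hbit])), ext hu hbit⟩

variable [Fintype W] [Fintype W']

lemma mem_interleavings_or_eq (h : IsDoubling D D' π bit β) (hq : (a, b, c, d) ∈ D'.interleavings) :
    (π a, π b, π c, π d) ∈ D.interleavings ∨ π a = π c ∨ π c = π b ∨
      D.pos (π a) < D.pos (π c) ∧ π b = π d := by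
  obtain ⟨hab, hcd, hside, hac, hcb, hbd⟩ := mem_interleavings.1 hq
  have hne := h.ne_of_between hac hcb
  have hne' := h.ne_of_between hcb hbd
  rcases h.pos_lt_or_eq hac with hac | hac
  · rcases h.pos_lt_or_eq hcb with hcb | hcb
    · rcases h.pos_lt_or_eq hbd with hbd | hbd
      · exact .inl (mem_interleavings.2 ⟨h.adj hab hne, h.adj hcd hne',
          by rw [← h.side_eq hab hne, ← h.side_eq hcd hne', hside], hac, hcb, hbd⟩)
      · exact .inr (.inr (.inr ⟨hac, hbd⟩))
    · exact .inr (.inr (.inl hcb))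
  · exact .inr (.inl hac)

lemma mem_image_wedgeEnds_or_twists [DecidableEq W] (h : IsDoubling D D' π bit β)
    (hq : (a, b, c, d) ∈ D'.interleavings) (hdeg : (π a, π b, π c, π d) ∉ D.interleavings) :
    (π a, π b, π c, π d) ∈ D.wedges.image D.wedgeEnds ∪
      (D.twists β).image fun p => (p.1, p.2, p.1, p.2) := by
  obtain ⟨hab, hcd, hside, hac, hcb, hbd⟩ := mem_interleavings.1 hq
  have hne := h.ne_of_between hac hcb
  have hne' := h.ne_of_between hcb hbd
  have hlt : D.pos (π a) < D.pos (π b) := (h.pos_lt_or_eq (hac.trans hcb)).resolve_right hne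
  have hlt' : D.pos (π c) < D.pos (π d) := (h.pos_lt_or_eq (hcb.trans hbd)).resolve_right hne'
  rw [h.side_eq hab hne, h.side_eq hcd hne'] at hside
  have hab' := h.adj hab hne
  have hcd' := h.adj hcd hne'
  rw [mem_union, mem_image, mem_image]
  rcases (h.mem_interleavings_or_eq hq).resolve_left hdeg with e | e | ⟨hac', e⟩
  · rcases h.pos_lt_or_eq hbd with hbd' | hbd'
    · refine .inl ⟨(π a, π b, π d), mem_wedges.2 ⟨hab', e ▸ hcd', e ▸ hside, hbd'⟩, ?_⟩
      simp only [wedgeEnds, if_pos hlt]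
      rw [e]
    · refine .inr ⟨(π a, π b), mem_twists.2 ⟨hab', hlt, ?_⟩, by simp only [e, hbd']⟩
      have hbit := h.bit_eq hab hne
      rwa [(h.bits_of_eq hac e).1, (h.bits_of_eq hbd hbd').1, zero_add, eq_comm] at hbit
  · have hside' : D.side (π b) (π a) = D.side (π b) (π d) := by rw [D.side_comm, hside, e]
    rw [e] at hcd' hlt'
    refine .inl ⟨(π b, π a, π d), mem_wedges.2 ⟨hab'.symm, hcd', hside', hlt.trans hlt'⟩, ?_⟩
    simp only [wedgeEnds, if_neg hlt.not_gt, if_pos hlt']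
    rw [e]
  · have hside' : D.side (π b) (π a) = D.side (π b) (π c) := by
      rw [D.side_comm, hside, D.side_comm, e]
    rw [← e] at hcd' hlt'
    refine .inl ⟨(π b, π a, π c), mem_wedges.2 ⟨hab'.symm, hcd'.symm, hside', hac'⟩, ?_⟩
    simp only [wedgeEnds, if_neg hlt.not_gt, if_neg hlt'.not_gt]
    rw [e]

lemma eq_of_degenerate (h : IsDoubling D D' π bit β) {a b c d a' b' c' d' : W'}
    (hq : (a, b, c, d) ∈ D'.interleavings) (hq' : (a', b', c', d') ∈ D'.interleavings)
    (hdeg : (π a, π b, π c, π d) ∉ D.interleavings)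
    (hπ : (π a, π b, π c, π d) = (π a', π b', π c', π d')) : (a, b, c, d) = (a', b', c', d') := by
  obtain ⟨hab, hcd, -, hac, hcb, hbd⟩ := mem_interleavings.1 hq
  obtain ⟨hab', hcd', -, hac', hcb', hbd'⟩ := mem_interleavings.1 hq'
  obtain ⟨ea, eb, ec, ed⟩ : π a = π a' ∧ π b = π b' ∧ π c = π c' ∧ π d = π d' := by simpa using hπ
  obtain ⟨hbit, hbit'⟩ : (bit a = bit a' ∨ bit b = bit b') ∧ (bit c = bit c' ∨ bit d = bit d') := by
    rcases (h.mem_interleavings_or_eq hq).resolve_left hdeg with e | e | ⟨-, e⟩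
    · have hbits := h.bits_of_eq hac e
      have hbits' := h.bits_of_eq hac' (ea ▸ ec ▸ e)
      exact ⟨.inl (hbits.1.trans hbits'.1.symm), .inl (hbits.2.trans hbits'.2.symm)⟩
    · have hbits := h.bits_of_eq hcb e
      have hbits' := h.bits_of_eq hcb' (ec ▸ eb ▸ e)
      exact ⟨.inr (hbits.2.trans hbits'.2.symm), .inl (hbits.1.trans hbits'.1.symm)⟩
    · have hbits := h.bits_of_eq hbd e
      have hbits' := h.bits_of_eq hbd' (eb ▸ ed ▸ e)
      exact ⟨.inr (hbits.1.trans hbits'.1.symm), .inr (hbits.2.trans hbits'.2.symm)⟩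
  obtain ⟨rfl, rfl⟩ := h.edge_ext hab hab' (h.ne_of_between hac hcb) ea eb hbit
  obtain ⟨rfl, rfl⟩ := h.edge_ext hcd hcd' (h.ne_of_between hcb hbd) ec ed hbit'
  rfl

open scoped Classical in
lemma card_degenerate_le (h : IsDoubling D D' π bit β) :
    #{q ∈ D'.interleavings | (π q.1, π q.2.1, π q.2.2.1, π q.2.2.2) ∉ D.interleavings} ≤
      #D.wedges + #(D.twists β) := by
  have hcard := (card_union_le (D.wedges.image D.wedgeEnds)
    ((D.twists β).image fun p => (p.1, p.2, p.1, p.2))).trans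
      (add_le_add card_image_le card_image_le)
  refine (card_le_card_of_injOn
    (fun q => (π q.1, π q.2.1, π q.2.2.1, π q.2.2.2)) ?_ ?_).trans hcard
  · intro q hq
    obtain ⟨hq, hdeg⟩ := mem_filter.1 hq
    exact h.mem_image_wedgeEnds_or_twists hq hdeg
  · intro q hq q' hq' hπ
    obtain ⟨hq, hdeg⟩ := mem_filter.1 hq
    exact h.eq_of_degenerate hq (mem_filter.1 hq').1 hdeg hπ

open scoped Classical in
lemma card_nondegenerate_le (h : IsDoubling D D' π bit β) :
    #{q ∈ D'.interleavings | (π q.1, π q.2.1, π q.2.2.1, π q.2.2.2) ∈ D.interleavings} ≤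
      4 * #D.interleavings := by
  have hcard : #(D.interleavings ×ˢ (univ : Finset (ZMod 2 × ZMod 2))) =
      4 * #D.interleavings := by
    rw [card_product, card_univ, Fintype.card_prod, ZMod.card, mul_comm]
  rw [← hcard]
  refine card_le_card_of_injOn
    (fun q => ((π q.1, π q.2.1, π q.2.2.1, π q.2.2.2), bit q.1, bit q.2.2.1)) ?_ ?_
  · intro q hq
    exact mem_product.2 ⟨(mem_filter.1 hq).2, mem_univ _⟩
  · rintro ⟨a, b, c, d⟩ hq ⟨a', b', c', d'⟩ hq' heq
    obtain ⟨⟨ea, eb, ec, ed⟩, hbit, hbit'⟩ : (π a = π a' ∧ π b = π b' ∧ π c = π c' ∧ π d = π d') ∧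
        bit a = bit a' ∧ bit c = bit c' := by simpa using heq
    obtain ⟨hab, hcd, -, hac, hcb, hbd⟩ := mem_interleavings.1 (mem_filter.1 hq).1
    obtain ⟨hab', hcd', -⟩ := mem_interleavings.1 (mem_filter.1 hq').1
    obtain ⟨rfl, rfl⟩ := h.edge_ext hab hab' (h.ne_of_between hac hcb) ea eb (.inl hbit)
    obtain ⟨rfl, rfl⟩ := h.edge_ext hcd hcd' (h.ne_of_between hcb hbd) ec ed (.inl hbit')
    rfl

theorem card_interleavings_le (h : IsDoubling D D' π bit β) :
    #D'.interleavings ≤ 4 * #D.interleavings + #D.wedges + #(D.twists β) := by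
  classical
  rw [← card_filter_add_card_filter_not
    (p := fun q => (π q.1, π q.2.1, π q.2.2.1, π q.2.2.2) ∈ D.interleavings), add_assoc]
  exact add_le_add h.card_nondegenerate_le h.card_degenerate_le

end IsDoubling

open scoped Classical in
/-- The neighbors of `v` along edges on a given side of the spine. -/
noncomputable def sideNeighbors [Fintype W] (D : SpineDrawing H) (s : Bool) (v : W) : Finset W :=
  {u | H.Adj v u ∧ D.side v u = s}

lemma mem_sideNeighbors [Fintype W] {s : Bool} {v u : W} :
    u ∈ D.sideNeighbors s v ↔ H.Adj v u ∧ D.side v u = s := by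
  simp only [sideNeighbors, mem_filter, mem_univ, true_and]

theorem card_wedges_le [Fintype W] (D : SpineDrawing H) :
    #D.wedges ≤ ∑ v, ∑ s, (#(D.sideNeighbors s v)).choose 2 := by
  classical
  have hcard (p : W × Bool) : (#(D.sideNeighbors p.2 p.1)).choose 2 =
      #((D.sideNeighbors p.2 p.1).offDiag.image Sym2.mk.uncurry) := (Sym2.card_image_offDiag _).symm
  rw [← Fintype.sum_prod_type', sum_congr rfl fun p _ => hcard p, ← card_sigma]
  refine card_le_card_of_injOn
    (fun q => ⟨(q.1, D.side q.1 q.2.1), s(q.2.1, q.2.2)⟩) ?_ ?_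
  · rintro ⟨v, b, d⟩ hq
    obtain ⟨hb, hd, hside, hlt⟩ := mem_wedges.1 hq
    exact mem_sigma.2 ⟨mem_univ _, mem_image.2 ⟨(b, d), mem_offDiag.2
      ⟨mem_sideNeighbors.2 ⟨hb, rfl⟩, mem_sideNeighbors.2 ⟨hd, hside.symm⟩,
        fun h => hlt.ne (congrArg D.pos h)⟩, rfl⟩⟩
  · rintro ⟨v, b, d⟩ hq ⟨v', b', d'⟩ hq' heq
    obtain ⟨-, -, -, hlt⟩ := mem_wedges.1 hq
    obtain ⟨-, -, -, hlt'⟩ := mem_wedges.1 hq'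
    simp only [Sigma.mk.injEq, Prod.mk.injEq, heq_eq_eq] at heq
    obtain ⟨⟨rfl, -⟩, hpair⟩ := heq
    rcases Sym2.eq_iff.1 hpair with ⟨rfl, rfl⟩ | ⟨rfl, rfl⟩
    · rfl
    · exact absurd hlt' hlt.not_gt

end SpineDrawing

section PrefixSums

variable {m : ℕ}

/-- The inverse of the Gray code `y ↦ (y₀, y₀ + y₁, y₁ + y₂, …)`. -/
def prefixSum (x : Fin m → ZMod 2) (i : Fin m) : ZMod 2 := ∑ j, if j ≤ i then x j else 0

/-- The sum of the first four terms of a sequence. -/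
def headParity (y : Fin m → ZMod 2) : ZMod 2 := ∑ i, if i.val < 4 then y i else 0

/-- The sum of all but the first four terms of a sequence. -/
def tailParity (y : Fin m → ZMod 2) : ZMod 2 := ∑ i, if i.val < 4 then 0 else y i

lemma prefixSum_add (x y : Fin m → ZMod 2) : prefixSum (x + y) = prefixSum x + prefixSum y := by
  funext i
  simp only [prefixSum, Pi.add_apply, ← Finset.sum_add_distrib, ite_add_ite, add_zero]

lemma prefixSum_last (x : Fin (m + 1) → ZMod 2) : prefixSum x (Fin.last m) = ∑ i, x i :=
  Finset.sum_congr rfl fun i _ => if_pos (Fin.le_last i)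

lemma init_prefixSum (x : Fin (m + 1) → ZMod 2) :
    Fin.init (prefixSum x) = prefixSum (Fin.init x) := by
  funext i
  simp [Fin.init, prefixSum, Fin.sum_univ_castSucc]

lemma prefixSum_cons (a : ZMod 2) (x : Fin m → ZMod 2) :
    prefixSum (Fin.cons a x) = Fin.cons a fun i => a + prefixSum x i := by
  funext i
  cases i using Fin.cases <;> simp [prefixSum, Fin.sum_univ_succ]

lemma prefixSum_injective : Function.Injective (prefixSum (m := m)) := by
  induction m with
  | zero => exact Function.injective_of_subsingleton _
  | succ m ih =>
    intro x y h
    have hinit : Fin.init x = Fin.init y := ih (by rw [← init_prefixSum, h, init_prefixSum])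
    have hlast := congrFun h (Fin.last m)
    rw [prefixSum_last, prefixSum_last, Fin.sum_univ_castSucc, Fin.sum_univ_castSucc] at hlast
    have hsum : ∑ i : Fin m, x i.castSucc = ∑ i : Fin m, y i.castSucc :=
      congrArg (fun z : Fin m → ZMod 2 => ∑ i, z i) hinit
    rw [hsum] at hlast
    rw [← Fin.snoc_init_self x, ← Fin.snoc_init_self y, hinit, add_left_cancel hlast]

lemma headParity_add_tailParity (y : Fin m → ZMod 2) :
    headParity y + tailParity y = ∑ i, y i := by
  simp only [headParity, tailParity, ← Finset.sum_add_distrib, ite_add_ite, zero_add, add_zero,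
    ite_self]

lemma headParity_init (hm : 4 ≤ m) (y : Fin (m + 1) → ZMod 2) :
    headParity (Fin.init y) = headParity y := by
  simp [headParity, Fin.sum_univ_castSucc, Fin.init, hm]

lemma tailParity_eq_init_add (hm : 4 ≤ m) (y : Fin (m + 1) → ZMod 2) :
    tailParity y = tailParity (Fin.init y) + y (Fin.last m) := by
  simp [tailParity, Fin.sum_univ_castSucc, Fin.init, hm]

lemma init_add_single_castSucc (x : Fin (m + 1) → ZMod 2) (i : Fin m) :
    Fin.init (x + Pi.single i.castSucc 1) = Fin.init x + Pi.single i 1 := by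
  funext j
  simp [Fin.init, Pi.single_apply]

lemma init_add_single_last (x : Fin (m + 1) → ZMod 2) :
    Fin.init (x + Pi.single (Fin.last m) 1) = Fin.init x := by
  funext j
  simp [Fin.init, (Fin.castSucc_lt_last j).ne]

end PrefixSums

/-- The points of the spine: `(0, x)` and `(1, y)` are vertices of the two halves of the cube, and
`(2, y)` is the middle of the edge that joins the halves at `(1, y)`. -/
abbrev CubePoint (m : ℕ) := Fin 3 × (Fin m → ZMod 2)

namespace CubePoint

variable {m : ℕ}

/-- The first point after `(0, x)`, where `prefixSum x = y`, on the edge or path of length two that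
leads from `(0, x)` to `(1, y)`. -/
def rungEnd (y : Fin m → ZMod 2) : CubePoint m := (if headParity y = 0 then 1 else 2, y)

/-- The links between the points of the spine: the edges of two hypercubes, and an edge or a path of
length two from `(0, x)` to `(1, prefixSum x)`. -/
inductive Link : CubePoint m → CubePoint m → Prop
  | flip (k : Fin 3) (hk : k ≠ 2) (x : Fin m → ZMod 2) (i : Fin m) :
      Link (k, x) (k, x + Pi.single i 1)
  | rung (x : Fin m → ZMod 2) : Link (0, x) (rungEnd (prefixSum x))
  | bend (y : Fin m → ZMod 2) (hy : headParity y = 1) : Link (2, y) (1, y)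

end CubePoint

open CubePoint in
/-- The graph of the links: the locally twisted cube, with some of its edges subdivided. -/
def subdividedCube (m : ℕ) : SimpleGraph (CubePoint m) := SimpleGraph.fromRel Link

namespace CubePoint

variable {m : ℕ} {p q : CubePoint m} {w u : CubePoint (m + 1)}

/-- The point obtained by deleting the last bit. -/
def proj (w : CubePoint (m + 1)) : CubePoint m := (w.1, Fin.init w.2)

/-- Which of the two lifts of its projection a point is, in the order of the spine. -/
def bit (w : CubePoint (m + 1)) : ZMod 2 := ∑ i, w.2 i + if w.1 = 1 then 0 else 1

/-- The difference of the bits of the ends of a lift of a link. -/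
def voltage (p q : CubePoint m) : ZMod 2 :=
  if p.1 = 0 ∧ q.1 ≠ 0 then 1 + tailParity q.2
  else if q.1 = 0 ∧ p.1 ≠ 0 then 1 + tailParity p.2 else 1

lemma voltage_comm (p q : CubePoint m) : voltage p q = voltage q p := by
  unfold voltage
  split_ifs <;> first | rfl | tauto

lemma rungEnd_fst_ne_zero (y : Fin m → ZMod 2) : (rungEnd y).1 ≠ 0 := by
  change (if headParity y = 0 then 1 else 2 : Fin 3) ≠ 0
  split_ifs <;> decide

lemma proj_rungEnd (hm : 4 ≤ m) (y : Fin (m + 1) → ZMod 2) :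
    proj (rungEnd y) = rungEnd (Fin.init y) := by
  rw [rungEnd, ← headParity_init hm]
  rfl

lemma eq_of_proj_eq_of_bit_eq (hproj : proj w = proj u) (hbit : bit w = bit u) : w = u := by
  obtain ⟨k, x⟩ := w
  obtain ⟨l, y⟩ := u
  obtain ⟨rfl, hinit⟩ : k = l ∧ Fin.init x = Fin.init y := Prod.ext_iff.1 hproj
  have hsum := congrArg (fun z : Fin m → ZMod 2 => ∑ i, z i) hinit
  have hlast : x (Fin.last m) = y (Fin.last m) := by
    have h := add_right_cancel hbit
    rw [Fin.sum_univ_castSucc, Fin.sum_univ_castSucc] at h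
    exact add_left_cancel (hsum ▸ h)
  rw [← Fin.snoc_init_self x, ← Fin.snoc_init_self y, hinit, hlast]

lemma bit_rungEnd (y : Fin (m + 1) → ZMod 2) : bit (rungEnd y) = tailParity y := by
  have parity : ∀ a : ZMod 2, (if (if a = 0 then 1 else 2 : Fin 3) = 1 then 0 else 1) = a := by
    decide
  rw [bit, show (if (rungEnd y).1 = 1 then 0 else 1) = headParity y from parity _, add_comm,
    rungEnd, ← headParity_add_tailParity, ← add_assoc, CharTwo.add_self_eq_zero, zero_add]

lemma bit_zero (x : Fin (m + 1) → ZMod 2) : bit (0, x) = prefixSum x (Fin.last m) + 1 := by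
  rw [prefixSum_last]
  rfl

lemma bit_flip (k : Fin 3) (x : Fin (m + 1) → ZMod 2) (i : Fin (m + 1)) :
    bit (k, x + Pi.single i 1) = bit (k, x) + 1 := by
  simp only [bit, Pi.add_apply, Finset.sum_add_distrib, Finset.sum_pi_single', Finset.mem_univ,
    if_true, add_right_comm]

lemma bit_bend (y : Fin (m + 1) → ZMod 2) : bit (1, y) = bit (2, y) + 1 := by
  simp [bit, add_assoc, CharTwo.add_self_eq_zero]

lemma Link.proj_eq_or (hm : 4 ≤ m) (h : Link w u) : (w.1 ≠ 2 ∧ proj w = proj u) ∨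
    (Link (proj w) (proj u) ∧ bit u = bit w + voltage (proj w) (proj u)) := by
  cases h with
  | flip k hk x i =>
    cases i using Fin.lastCases with
    | last => exact .inl ⟨hk, Prod.ext rfl (init_add_single_last x).symm⟩
    | cast i =>
      have hproj : proj (k, x + Pi.single i.castSucc 1) = (k, Fin.init x + Pi.single i 1) :=
        Prod.ext rfl (init_add_single_castSucc x i)
      refine .inr ⟨hproj ▸ .flip k hk _ i, ?_⟩
      rw [bit_flip, voltage, if_neg fun h => h.2 h.1, if_neg fun h => h.2 h.1]
  | rung x =>
    rw [proj_rungEnd hm, init_prefixSum]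
    refine .inr ⟨.rung _, ?_⟩
    rw [bit_rungEnd, bit_zero, voltage, if_pos ⟨rfl, rungEnd_fst_ne_zero _⟩,
      tailParity_eq_init_add hm, init_prefixSum]
    rw [← add_assoc, add_assoc _ 1 1, CharTwo.add_self_eq_zero, add_zero, add_comm]
    rfl
  | bend y hy => exact .inr ⟨.bend _ (by rw [headParity_init hm, hy]), bit_bend y⟩

lemma Link.ne (h : Link p q) : p ≠ q := by
  cases h with
  | flip k hk x i => simp
  | rung x => exact fun h => rungEnd_fst_ne_zero _ (congrArg Prod.fst h).symm
  | bend y hy => simp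

lemma proj_eq_or_adj (hm : 4 ≤ m) (h : (subdividedCube (m + 1)).Adj w u) :
    (w.1 ≠ 2 ∧ proj w = proj u) ∨
      ((subdividedCube m).Adj (proj w) (proj u) ∧ bit u = bit w + voltage (proj w) (proj u)) := by
  rcases h.2 with h | h
  · exact (h.proj_eq_or hm).imp_right fun ⟨h, hbit⟩ => ⟨⟨h.ne, .inl h⟩, hbit⟩
  · refine (h.proj_eq_or hm).imp (fun ⟨h2, hproj⟩ => ?_) fun ⟨h, hbit⟩ => ⟨⟨h.ne.symm, .inr h⟩, ?_⟩
    · exact ⟨fun h => h2 ((congrArg Prod.fst hproj).trans h), hproj.symm⟩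
    · rw [hbit, voltage_comm, add_assoc, CharTwo.add_self_eq_zero, add_zero]

lemma eq_rungEnd_of_adj (h : (subdividedCube m).Adj p q) (hp : p.1 = 0) (hq : q.1 ≠ 0) :
    q = rungEnd (prefixSum p.2) := by
  rcases h.2 with h | h <;> cases h with
  | flip k hk x i => exact absurd hp hq
  | rung x => first | rfl | exact absurd rfl hq
  | bend y hy => simp at hp

end CubePoint

namespace SpineDrawing

open Finset

section Doubling

variable {W W' : Type*} {H : SimpleGraph W} {H' : SimpleGraph W'} {D : SpineDrawing H}
  {D' : SpineDrawing H'} {π : W' → W} {bit : W' → ZMod 2} {β : W → W → ZMod 2}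

open scoped Classical in
lemma IsDoubling.card_sideNeighbors_le [Fintype W] [Fintype W'] (h : IsDoubling D D' π bit β)
    (s : Bool) (w : W') : #(D'.sideNeighbors s w) ≤ #(D.sideNeighbors s (π w)) +
      if ∃ u ∈ D'.sideNeighbors s w, π w = π u then 1 else 0 := by
  rw [← card_filter_add_card_filter_not (p := fun u => π w ≠ π u)]
  refine add_le_add (card_le_card_of_injOn π ?_ ?_) ?_
  · intro u hu
    obtain ⟨hu, hne⟩ := mem_filter.1 hu
    obtain ⟨hadj, hside⟩ := mem_sideNeighbors.1 hu
    exact mem_sideNeighbors.2 ⟨h.adj hadj hne, h.side_eq hadj hne ▸ hside⟩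
  · intro u hu v hv huv
    obtain ⟨hu, hne⟩ := mem_filter.1 hu
    have hadj := (mem_sideNeighbors.1 hu).1
    have hadj' := (mem_sideNeighbors.1 (mem_filter.1 hv).1).1
    exact (h.edge_ext hadj hadj' hne rfl huv (.inl rfl)).2
  · split_ifs with hcopy
    · refine card_le_one.2 fun u hu v hv => ?_
      simp only [mem_filter, mem_sideNeighbors, not_not] at hu hv
      have two_bits : ∀ a b c : ZMod 2, a ≠ b → a ≠ c → b = c := by decide
      have ext {x y} (hπ : π x = π y) (hbit : bit x = bit y) : x = y :=
        D'.pos_injective (by rw [h.pos_eq, h.pos_eq, hπ, hbit])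
      exact ext (hu.2.symm.trans hv.2) (two_bits (bit w) _ _ (fun e => hu.1.1.ne (ext hu.2 e))
        fun e => hv.1.1.ne (ext hv.2 e))
    · rw [Nat.le_zero, card_eq_zero, filter_eq_empty_iff]
      exact fun u hu hπ => hcopy ⟨u, hu, not_not.1 hπ⟩

end Doubling

open CubePoint

variable {m : ℕ} {D : SpineDrawing (subdividedCube m)}

/-- The side of the spine on which a vertex has fewer edges. -/
noncomputable def lighterSide (D : SpineDrawing (subdividedCube m)) (w : CubePoint m) : Bool :=
  decide (#(D.sideNeighbors true w) ≤ #(D.sideNeighbors false w))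

/-- The spine drawing in which each vertex is replaced by two consecutive ones, and the new edge
between them is drawn on the side where the vertex has fewer edges. -/
noncomputable def double (D : SpineDrawing (subdividedCube m)) :
    SpineDrawing (subdividedCube (m + 1)) where
  pos w := 2 * D.pos (proj w) + (bit w).val
  pos_injective w u h := by
    have hw := (bit w).val_lt
    have hu := (bit u).val_lt
    dsimp only at h
    exact eq_of_proj_eq_of_bit_eq (D.pos_injective (by omega)) (ZMod.val_injective 2 (by omega))
  side w u := if proj w = proj u then D.lighterSide (proj w) else D.side (proj w) (proj u)
  side_comm w u := by
    by_cases h : proj w = proj u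
    · rw [if_pos h, if_pos h.symm, h]
    · rw [if_neg h, if_neg (Ne.symm h), D.side_comm]

lemma isDoubling_double (hm : 4 ≤ m) (D : SpineDrawing (subdividedCube m)) :
    IsDoubling D D.double proj bit voltage where
  pos_eq _ := rfl
  adj h hne := ((proj_eq_or_adj hm h).resolve_left fun e => hne e.2).1
  side_eq _ hne := if_neg hne
  bit_eq h hne := ((proj_eq_or_adj hm h).resolve_left fun e => hne e.2).2

lemma card_sideNeighbors_double_le (hm : 4 ≤ m) (D : SpineDrawing (subdividedCube m)) (s : Bool)
    (w : CubePoint (m + 1)) : #(D.double.sideNeighbors s w) ≤ #(D.sideNeighbors s (proj w)) +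
      if w.1 ≠ 2 ∧ D.lighterSide (proj w) = s then 1 else 0 := by
  classical
  refine ((D.isDoubling_double hm).card_sideNeighbors_le s w).trans (Nat.add_le_add_left ?_ _)
  by_cases h : ∃ u ∈ D.double.sideNeighbors s w, proj w = proj u
  · obtain ⟨u, hu, hproj⟩ := h
    obtain ⟨hadj, hside⟩ := mem_sideNeighbors.1 hu
    have hw : w.1 ≠ 2 := ((proj_eq_or_adj hm hadj).resolve_right fun e => e.1.ne hproj).1
    have hlight : D.lighterSide (proj w) = s := (if_pos hproj).symm.trans hside
    rw [if_pos (show w.1 ≠ 2 ∧ D.lighterSide (proj w) = s from ⟨hw, hlight⟩)]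
    split_ifs <;> simp only [le_refl, zero_le]
  · rw [if_neg h]
    exact Nat.zero_le _

/-- The edges at each vertex are divided evenly between the two sides of the spine, and the middles
of the paths of length two have at most one edge on each side. -/
structure Balanced (D : SpineDrawing (subdividedCube m)) : Prop where
  middle : ∀ w : CubePoint m, w.1 = 2 → ∀ s, #(D.sideNeighbors s w) ≤ 1
  half : ∀ w : CubePoint m, w.1 ≠ 2 → ∀ s, 2 * #(D.sideNeighbors s w) ≤ m + 2
  total : ∀ w : CubePoint m, w.1 ≠ 2 →
    #(D.sideNeighbors true w) + #(D.sideNeighbors false w) ≤ m + 1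

lemma Balanced.double (hm : 4 ≤ m) (hD : D.Balanced) : D.double.Balanced where
  middle w hw s := by
    have h := D.card_sideNeighbors_double_le hm s w
    rw [if_neg fun h => h.1 hw] at h
    exact h.trans (hD.middle (proj w) hw s)
  half w hw s := by
    have h := D.card_sideNeighbors_double_le hm s w
    have hhalf := hD.half (proj w) hw s
    have htotal := hD.total (proj w) hw
    unfold lighterSide at h
    by_cases hle : #(D.sideNeighbors true (proj w)) ≤ #(D.sideNeighbors false (proj w)) <;>
      cases s <;> simp only [hle, hw, decide_true, decide_false, ne_eq, not_false_eq_true, true_and,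
        Bool.true_eq_false, Bool.false_eq_true, if_true, if_false] at h <;> omega
  total w hw := by
    have h := D.card_sideNeighbors_double_le hm true w
    have h' := D.card_sideNeighbors_double_le hm false w
    have htotal := hD.total (proj w) hw
    cases hs : D.lighterSide (proj w) <;>
      simp only [hs, hw, ne_eq, not_false_eq_true, true_and, Bool.true_eq_false,
        Bool.false_eq_true, if_true, if_false] at h h' <;> omega

lemma choose_two_add_choose_two_le {a b : ℕ} (ha : 2 * a ≤ m + 2) (hb : 2 * b ≤ m + 2)
    (hab : a + b ≤ m + 1) : a.choose 2 + b.choose 2 ≤ m ^ 2 / 4 := by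
  rw [Nat.le_div_iff_mul_le four_pos]
  rcases le_or_gt (a + b) 1 with h | h
  · rw [Nat.choose_eq_zero_of_lt (by omega), Nat.choose_eq_zero_of_lt (by omega)]
    exact Nat.zero_le _
  have ha : 2 * (a : ℚ) ≤ m + 2 := mod_cast ha
  have hb : 2 * (b : ℚ) ≤ m + 2 := mod_cast hb
  have hab : (a + b : ℚ) ≤ m + 1 := mod_cast hab
  have h : 2 ≤ (a + b : ℚ) := mod_cast h
  suffices ((a.choose 2 + b.choose 2) * 4 : ℚ) ≤ m ^ 2 by exact_mod_cast this
  rw [Nat.cast_choose_two, Nat.cast_choose_two]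
  nlinarith [mul_nonneg (sub_nonneg.2 ha) (sub_nonneg.2 hb),
    mul_nonneg (sub_nonneg.2 hab) (sub_nonneg.2 h)]

lemma Balanced.card_wedges_le (hD : D.Balanced) : #D.wedges ≤ m ^ 2 / 4 * 2 ^ (m + 1) := by
  have hvertex (w : CubePoint m) : ∑ s, (#(D.sideNeighbors s w)).choose 2 ≤
      if w.1 = 2 then 0 else m ^ 2 / 4 := by
    rw [Fintype.sum_bool]
    split_ifs with hw
    · rw [Nat.choose_eq_zero_of_lt (Nat.lt_succ_of_le (hD.middle w hw _)),
        Nat.choose_eq_zero_of_lt (Nat.lt_succ_of_le (hD.middle w hw _))]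
    · exact choose_two_add_choose_two_le (hD.half w hw _) (hD.half w hw _) (hD.total w hw)
  calc #D.wedges ≤ ∑ w : CubePoint m, if w.1 = 2 then 0 else m ^ 2 / 4 :=
        D.card_wedges_le.trans (sum_le_sum fun w _ => hvertex w)
    _ = m ^ 2 / 4 * 2 ^ (m + 1) := by
        simp [Fintype.sum_prod_type, Fin.sum_univ_succ]
        ring

open scoped Classical in
lemma card_twists_voltage_le (D : SpineDrawing (subdividedCube m)) :
    #(D.twists voltage) ≤ #{y : Fin m → ZMod 2 | tailParity y = 1} := by
  let rung (x : Fin m → ZMod 2) : CubePoint m × CubePoint m := ((0, x), rungEnd (prefixSum x))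
  have hrungs : D.twists voltage ⊆
      ({x | tailParity (prefixSum x) = 1} : Finset (Fin m → ZMod 2)).image fun x =>
        if D.pos (rung x).1 < D.pos (rung x).2 then rung x else (rung x).swap := by
    rintro ⟨p, q⟩ h
    obtain ⟨hadj, hlt, hvolt⟩ := mem_twists.1 h
    have tail : ∀ a : ZMod 2, 1 + a = 0 → a = 1 := by decide
    have hrung {p q : CubePoint m} (hadj : (subdividedCube m).Adj p q) (hp : p.1 = 0)
        (hq : q.1 ≠ 0) : rung p.2 = (p, q) :=
      Prod.ext (Prod.ext hp.symm rfl) (eq_rungEnd_of_adj hadj hp hq).symm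
    unfold voltage at hvolt
    split_ifs at hvolt with hpq hqp
    · have e := hrung hadj hpq.1 hpq.2
      have hq : prefixSum p.2 = q.2 := congrArg (fun r => r.2.2) e
      refine mem_image.2 ⟨p.2, mem_filter.2 ⟨mem_univ _, hq ▸ tail _ hvolt⟩, ?_⟩
      rw [e, if_pos hlt]
    · have e := hrung hadj.symm hqp.1 hqp.2
      have hp : prefixSum q.2 = p.2 := congrArg (fun r => r.2.2) e
      refine mem_image.2 ⟨q.2, mem_filter.2 ⟨mem_univ _, hp ▸ tail _ hvolt⟩, ?_⟩
      rw [e, if_neg hlt.le.not_gt, Prod.swap_prod_mk]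
    · exact absurd hvolt one_ne_zero
  refine (card_le_card hrungs).trans (card_image_le.trans ?_)
  refine card_le_card_of_injOn prefixSum (fun x hx => ?_) prefixSum_injective.injOn
  exact mem_filter.2 ⟨mem_univ _, (mem_filter.1 hx).2⟩

lemma card_tailParity_le (hm : 4 ≤ m) :
    #{y : Fin (m + 1) → ZMod 2 | tailParity y = 1} ≤ 2 ^ m := by
  have hcard : #(univ : Finset (Fin m → ZMod 2)) = 2 ^ m := by simp
  rw [← hcard]
  refine card_le_card_of_injOn Fin.init (fun _ _ => mem_univ _) fun y hy z hz hyz => ?_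
  have hy := (mem_filter.1 hy).2
  have hz := (mem_filter.1 hz).2
  rw [tailParity_eq_init_add hm] at hy hz
  rw [← hz, hyz, add_right_inj] at hy
  rw [← Fin.snoc_init_self y, ← Fin.snoc_init_self z, hyz, hy]

lemma tailParity_four (y : Fin 4 → ZMod 2) : tailParity y = 0 :=
  sum_eq_zero fun i _ => if_pos i.isLt

end SpineDrawing

namespace SpineDrawing

open Finset

variable {W : Type*} {H : SimpleGraph W} {D : SpineDrawing H}
  {spans : Bool → List (ℕ × ℕ)}

/-- Two numbers in increasing order, as the ends of an edge on the spine. -/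
def span (p q : ℕ) : ℕ × ℕ := (min p q, max p q)

lemma span_comm (p q : ℕ) : span p q = span q p := by
  rw [span, span, min_comm, max_comm]

lemma span_of_lt {p q : ℕ} (h : p < q) : span p q = (p, q) := by
  rw [span, min_eq_left h.le, max_eq_right h.le]

lemma span_right_injective (p : ℕ) : Function.Injective (span p) := by
  intro q r h
  obtain ⟨hmin, hmax⟩ := Prod.ext_iff.1 h
  dsimp only [span] at hmin hmax
  omega

/-- The pairs of spans in a list that interleave. -/
def crossingPairs (l : List (ℕ × ℕ)) : List ((ℕ × ℕ) × (ℕ × ℕ)) :=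
  (l ×ˢ l).filter fun p => p.1.1 < p.2.1 ∧ p.2.1 < p.1.2 ∧ p.1.2 < p.2.2

/-- The spans in a list with an end at a given position. -/
def spansAt (l : List (ℕ × ℕ)) (p : ℕ) : List (ℕ × ℕ) := l.filter fun q => q.1 = p ∨ q.2 = p

variable [Fintype W]

lemma card_interleavings_le_length
    (h : ∀ {a b}, H.Adj a b → span (D.pos a) (D.pos b) ∈ spans (D.side a b)) :
    #D.interleavings ≤ ∑ s, (crossingPairs (spans s)).length := by
  have hcard (s : Bool) := List.toFinset_card_le (crossingPairs (spans s))
  refine le_trans ?_ (sum_le_sum fun s _ => hcard s)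
  rw [← card_sigma]
  refine card_le_card_of_injOn (fun q => ⟨D.side q.1 q.2.1,
    (D.pos q.1, D.pos q.2.1), (D.pos q.2.2.1, D.pos q.2.2.2)⟩) ?_ ?_
  · rintro ⟨a, b, c, d⟩ hq
    obtain ⟨hab, hcd, hside, hac, hcb, hbd⟩ := mem_interleavings.1 hq
    have hspan := span_of_lt (hac.trans hcb) ▸ h hab
    have hspan' := span_of_lt (hcb.trans hbd) ▸ h hcd
    rw [← hside] at hspan'
    exact mem_sigma.2 ⟨mem_univ _, List.mem_toFinset.2 (List.mem_filter.2
      ⟨List.mem_product.2 ⟨hspan, hspan'⟩, decide_eq_true ⟨hac, hcb, hbd⟩⟩)⟩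
  · rintro ⟨a, b, c, d⟩ - ⟨a', b', c', d'⟩ - heq
    simpa [D.pos_injective.eq_iff, and_assoc] using (Sigma.mk.inj_iff.1 heq).2.eq

lemma card_sideNeighbors_le_length
    (h : ∀ {a b}, H.Adj a b → span (D.pos a) (D.pos b) ∈ spans (D.side a b)) (s : Bool) (a : W) :
    #(D.sideNeighbors s a) ≤ (spansAt (spans s) (D.pos a)).length := by
  refine le_trans (card_le_card_of_injOn (fun b => span (D.pos a) (D.pos b)) ?_
    ((span_right_injective _).comp D.pos_injective).injOn) (List.toFinset_card_le _)
  intro b hb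
  obtain ⟨hadj, rfl⟩ := mem_sideNeighbors.1 hb
  refine List.mem_toFinset.2 (List.mem_filter.2 ⟨h hadj, decide_eq_true ?_⟩)
  exact (le_total (D.pos a) (D.pos b)).imp (fun h => min_eq_left h) fun h => max_eq_left h

end SpineDrawing

namespace FourBits

open CubePoint SpineDrawing
open scoped Finset

/-- The positions on the spine of the points of `CubePoint 4`, in lexicographic order. -/
def positions : List ℕ :=
  [35, 33, 9, 10, 36, 32, 8, 11, 29, 30, 14, 13, 28, 31, 15, 12, 0, 1, 39, 2, 5, 4, 6, 3, 25, 24,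
  26, 23, 19, 21, 18, 22, 40, 34, 37, 41, 7, 42, 43, 38, 27, 44, 45, 16, 46, 20, 17, 47]

/-- The spans of the links above the spine. -/
def above : List (ℕ × ℕ) :=
  [(0, 25), (0, 35), (0, 39), (1, 4), (1, 24), (1, 34), (2, 3), (2, 23), (3, 22), (4, 11),
  (4, 21), (5, 6), (5, 7), (5, 19), (6, 18), (8, 9), (8, 11), (8, 15), (9, 10), (9, 14),
  (10, 13), (11, 12), (12, 13), (13, 20), (14, 15), (14, 19), (15, 16), (17, 18), (18, 19),
  (21, 22), (21, 24), (22, 23), (24, 31), (25, 26), (25, 27), (26, 39), (28, 29), (28, 31),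
  (28, 36), (29, 30), (29, 35), (30, 33), (31, 32), (32, 33), (36, 38), (37, 39)]

/-- The spans of the links below the spine. -/
def below : List (ℕ × ℕ) :=
  [(0, 1), (0, 5), (1, 2), (2, 9), (2, 39), (3, 4), (3, 6), (3, 38), (4, 5), (6, 32), (6, 39),
  (7, 8), (8, 36), (9, 35), (10, 11), (10, 33), (10, 37), (11, 32), (12, 15), (12, 26), (12, 31),
  (13, 14), (13, 30), (14, 29), (15, 28), (16, 23), (17, 30), (18, 22), (18, 26), (19, 21),
  (19, 25), (20, 21), (22, 29), (23, 24), (23, 26), (24, 25), (27, 28), (30, 31), (32, 36),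
  (33, 34), (33, 35), (35, 36)]

/-- The position of a point on the spine. -/
def position (w : CubePoint 4) : ℕ :=
  positions.getD (16 * w.1.val + 8 * (w.2 0).val + 4 * (w.2 1).val + 2 * (w.2 2).val + (w.2 3).val)
    0

lemma position_injective : Function.Injective position := by
  decide +kernel

/-- A spine drawing of the subdivided cube with four bits, found by computer. -/
def drawing : SpineDrawing (subdividedCube 4) where
  pos := position
  pos_injective := position_injective
  side w u := decide (span (position w) (position u) ∈ above)
  side_comm w u := by rw [span_comm]

/-- The spans of the links on a given side of the spine. -/
def spans (s : Bool) : List (ℕ × ℕ) := if s then above else below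

lemma span_flip_mem : ∀ k : Fin 3, k ≠ 2 → ∀ (x : Fin 4 → ZMod 2) (i : Fin 4),
    span (position (k, x)) (position (k, x + Pi.single i 1)) ∈ above ++ below := by
  decide +kernel

lemma span_rung_mem : ∀ x : Fin 4 → ZMod 2,
    span (position (0, x)) (position (rungEnd (prefixSum x))) ∈ above ++ below := by
  decide +kernel

lemma span_bend_mem : ∀ y : Fin 4 → ZMod 2, headParity y = 1 →
    span (position (2, y)) (position (1, y)) ∈ above ++ below := by
  decide +kernel

lemma span_mem_append {w u : CubePoint 4} (h : Link w u) :
    span (position w) (position u) ∈ above ++ below := by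
  cases h with
  | flip k hk x i => exact span_flip_mem k hk x i
  | rung x => exact span_rung_mem x
  | bend y hy => exact span_bend_mem y hy

lemma span_mem_spans {w u : CubePoint 4} (h : (subdividedCube 4).Adj w u) :
    span (drawing.pos w) (drawing.pos u) ∈ spans (drawing.side w u) := by
  change span (position w) (position u) ∈ _
  have hmem : span (position w) (position u) ∈ above ++ below := by
    rcases h.2 with h | h
    · exact span_mem_append h
    · exact span_comm _ _ ▸ span_mem_append h
  by_cases ha : span (position w) (position u) ∈ above
  · simp [spans, drawing, ha]
  · simpa [spans, drawing, ha] using (List.mem_append.1 hmem).resolve_left ha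

lemma card_interleavings_le : #drawing.interleavings ≤ 68 :=
  (card_interleavings_le_length span_mem_spans).trans (by decide +kernel)

lemma length_spansAt_middle : ∀ (y : Fin 4 → ZMod 2) (s : Bool),
    (spansAt (spans s) (position (2, y))).length ≤ 1 := by
  decide +kernel

lemma length_spansAt_le : ∀ k : Fin 3, k ≠ 2 → ∀ (y : Fin 4 → ZMod 2) (s : Bool),
    (spansAt (spans s) (position (k, y))).length ≤ 3 := by
  decide +kernel

lemma length_spansAt_add_le : ∀ k : Fin 3, k ≠ 2 → ∀ y : Fin 4 → ZMod 2,
    (spansAt (spans true) (position (k, y))).length +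
      (spansAt (spans false) (position (k, y))).length ≤ 5 := by
  decide +kernel

lemma balanced : drawing.Balanced where
  middle := by
    rintro ⟨k, y⟩ rfl s
    exact (card_sideNeighbors_le_length span_mem_spans s _).trans (length_spansAt_middle y s)
  half := by
    rintro ⟨k, y⟩ hk s
    exact Nat.mul_le_mul_left 2 ((card_sideNeighbors_le_length span_mem_spans s (k, y)).trans
      (length_spansAt_le k hk y s))
  total := by
    rintro ⟨k, y⟩ hk
    exact (add_le_add (card_sideNeighbors_le_length span_mem_spans true (k, y))
      (card_sideNeighbors_le_length span_mem_spans false (k, y))).trans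
        (length_spansAt_add_le k hk y)

end FourBits

section LocallyTwistedCube

variable {m : ℕ}

/-- All but the last bit of a vertex of the locally twisted cube, in coordinates in which the edges
that preserve the last bit flip a single bit. -/
def coords (x : Fin (m + 1) → ZMod 2) : Fin m → ZMod 2 :=
  if x (Fin.last m) = 0 then Fin.init x else prefixSum (Fin.init x)

lemma coords_eq_cons (x : Fin (m + 2) → ZMod 2) :
    coords x = Fin.cons (x 0) fun i =>
      coords (Fin.tail x) i + if x (Fin.last (m + 1)) = 0 then 0 else x 0 := by
  have hinit : Fin.init x = Fin.cons (x 0) (Fin.init (Fin.tail x)) :=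
    (Fin.cons_self_tail (Fin.init x)).symm
  have hlast : Fin.tail x (Fin.last m) = x (Fin.last (m + 1)) := rfl
  unfold coords
  rw [hlast, hinit]
  split_ifs
  · simp only [add_zero]
  · simp only [prefixSum_cons, add_comm]

/-- Adjacency in the locally twisted cube, as it reads in coordinates. -/
def CoordsAdj (x y : Fin (m + 1) → ZMod 2) : Prop :=
  (x (Fin.last m) = y (Fin.last m) ∧ ∃ i, coords y = coords x + Pi.single i 1) ∨
    (x (Fin.last m) ≠ y (Fin.last m) ∧ Fin.init x = Fin.init y)

lemma CoordsAdj.symm {x y : Fin (m + 1) → ZMod 2} (h : CoordsAdj x y) : CoordsAdj y x := by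
  refine h.imp (fun ⟨hlast, i, hi⟩ => ⟨hlast.symm, i, ?_⟩) fun ⟨hlast, h⟩ => ⟨hlast.symm, h.symm⟩
  rw [hi, add_assoc, ← Pi.single_add, CharTwo.add_self_eq_zero, Pi.single_zero, add_zero]

lemma CoordsAdj.of_tail {x y : Fin (m + 2) → ZMod 2} (hhead : x 0 = y 0)
    (h : CoordsAdj (Fin.tail x) (Fin.tail y)) : CoordsAdj x y := by
  rcases h with ⟨hlast, i, hi⟩ | ⟨hlast, hinit⟩
  · have hlast : x (Fin.last (m + 1)) = y (Fin.last (m + 1)) := hlast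
    refine .inl ⟨hlast, i.succ, ?_⟩
    rw [coords_eq_cons, coords_eq_cons, hi, ← hlast, ← hhead]
    funext j
    cases j using Fin.cases with
    | zero => simp
    | succ j => simp [Pi.single_apply, add_right_comm]
  · refine .inr ⟨hlast, ?_⟩
    rw [← Fin.cons_self_tail (Fin.init x), ← Fin.cons_self_tail (Fin.init y)]
    exact congrArg₂ _ hhead hinit

lemma twistedPartner_last (x : Fin (m + 3) → ZMod 2) :
    twistedPartner x (Fin.last (m + 2)) = x (Fin.last (m + 2)) := by
  simp [twistedPartner, Fin.ext_iff]

lemma init_twistedPartner {x : Fin (m + 3) → ZMod 2} (h : x 0 = 0) :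
    Fin.init (twistedPartner x) =
      Fin.init x + Fin.cons 1 (Fin.cons (x (Fin.last (m + 2))) 0) := by
  funext j
  cases j using Fin.cases with
  | zero => simp [Fin.init, twistedPartner, h]
  | succ j =>
    cases j using Fin.cases with
    | zero => simp [Fin.init, twistedPartner]
    | succ j => simp [Fin.init, twistedPartner, Fin.ext_iff]

lemma coordsAdj_twistedPartner {x : Fin (m + 3) → ZMod 2} (h : x 0 = 0) :
    CoordsAdj x (twistedPartner x) := by
  have hsingle : (Pi.single 0 1 : Fin (m + 2) → ZMod 2) = Fin.cons 1 (Fin.cons 0 0) := by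
    funext j
    cases j using Fin.cases with
    | zero => rfl
    | succ j => cases j using Fin.cases <;> rfl
  have htwist : prefixSum (Fin.cons 1 (Fin.cons 1 0) : Fin (m + 2) → ZMod 2) =
      Pi.single 0 1 := by
    have hzero : prefixSum (0 : Fin m → ZMod 2) = 0 := by
      funext i
      simp [prefixSum]
    rw [hsingle, prefixSum_cons, prefixSum_cons, hzero]
    funext j
    cases j using Fin.cases with
    | zero => rfl
    | succ j => cases j using Fin.cases <;> rfl
  refine .inl ⟨(twistedPartner_last x).symm, 0, ?_⟩
  have bit : ∀ a : ZMod 2, a = 0 ∨ a = 1 := by decide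
  unfold coords
  rw [twistedPartner_last, init_twistedPartner h]
  rcases bit (x (Fin.last (m + 2))) with hlast | hlast
  · rw [hlast, if_pos rfl, if_pos rfl, hsingle]
  · rw [hlast, if_neg one_ne_zero, if_neg one_ne_zero, prefixSum_add, htwist]

lemma coordsAdj_of_adj {x y : Fin (m + 2) → ZMod 2} (h : (LTQ (m + 2)).Adj x y) :
    CoordsAdj x y := by
  induction m with
  | zero =>
    have square : ∀ x y : Fin 2 → ZMod 2, hammingDist x y = 1 → CoordsAdj x y := by
      unfold CoordsAdj
      decide
    exact square x y h
  | succ m ih =>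
    rcases h with ⟨hhead, h⟩ | ⟨hhead, rfl⟩ | ⟨hhead, rfl⟩
    · exact .of_tail hhead (ih h)
    · exact coordsAdj_twistedPartner hhead
    · exact (coordsAdj_twistedPartner hhead).symm

/-- The point of the spine at which a vertex of the locally twisted cube is placed. -/
def cubePoint (x : Fin (m + 1) → ZMod 2) : CubePoint m :=
  (if x (Fin.last m) = 0 then 0 else 1, coords x)

lemma cubePoint_of_last_eq_zero {x : Fin (m + 1) → ZMod 2} (h : x (Fin.last m) = 0) :
    cubePoint x = (0, Fin.init x) := by
  rw [cubePoint, coords, if_pos h, if_pos h]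

lemma cubePoint_of_last_ne_zero {x : Fin (m + 1) → ZMod 2} (h : x (Fin.last m) ≠ 0) :
    cubePoint x = (1, prefixSum (Fin.init x)) := by
  rw [cubePoint, coords, if_neg h, if_neg h]

lemma cubePoint_injective : Function.Injective (cubePoint (m := m)) := by
  intro x y h
  have bit : ∀ a b : ZMod 2, (if a = 0 then 0 else 1 : Fin 3) = (if b = 0 then 0 else 1) →
      a = b := by decide
  obtain ⟨hfst, hcoords⟩ := Prod.ext_iff.1 h
  have hlast := bit _ _ hfst
  have hinit : Fin.init x = Fin.init y := by
    dsimp only [cubePoint, coords] at hcoords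
    rw [hlast] at hcoords
    split_ifs at hcoords
    exacts [hcoords, prefixSum_injective hcoords]
  rw [← Fin.snoc_init_self x, ← Fin.snoc_init_self y, hinit, hlast]

lemma mem_range_cubePoint_iff {w : CubePoint m} : w ∈ Set.range cubePoint ↔ w.1 ≠ 2 := by
  constructor
  · rintro ⟨x, rfl⟩
    dsimp only [cubePoint]
    split_ifs <;> decide
  · obtain ⟨k, y⟩ := w
    intro hk
    fin_cases k
    · exact ⟨Fin.snoc y 0, by simp [cubePoint_of_last_eq_zero]⟩
    · obtain ⟨x, rfl⟩ := Finite.injective_iff_surjective.1 prefixSum_injective y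
      exact ⟨Fin.snoc x 1, by simp [cubePoint_of_last_ne_zero]⟩
    · exact absurd rfl hk

lemma eq_or_eq_of_adj_middle {w : CubePoint m} {x : Fin m → ZMod 2}
    (h : (subdividedCube m).Adj w (2, prefixSum x)) : w = (0, x) ∨ w = (1, prefixSum x) := by
  obtain ⟨k, y⟩ := w
  obtain ⟨-, h | h⟩ := h
  · generalize hd : ((2, prefixSum x) : CubePoint m) = d at h
    cases h with
    | flip k hk x i => exact absurd (congrArg Prod.fst hd).symm hk
    | rung y => exact .inl (by rw [prefixSum_injective (congrArg Prod.snd hd)])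
    | bend y hy => simp at hd
  · cases h with
    | flip k hk x i => exact absurd rfl hk
    | bend y hy => exact .inr rfl

end LocallyTwistedCube

namespace SpineDrawing

open CubePoint

variable {m : ℕ} {D : SpineDrawing (subdividedCube m)}

lemma map_eq_of_bendsAt {e : Sym2 (Fin (m + 1) → ZMod 2)} {x : Fin m → ZMod 2}
    (h : BendsAt (subdividedCube m) cubePoint e (2, prefixSum x)) :
    e.map cubePoint = s((0, x), (1, prefixSum x)) := by
  obtain ⟨u, v⟩ := e
  obtain ⟨-, hne, hadj⟩ := h
  have hne := cubePoint_injective.ne (Sym2.mk_isDiag_iff.not.1 hne)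
  change s(cubePoint u, cubePoint v) = _
  rcases eq_or_eq_of_adj_middle (hadj u (Sym2.mem_mk_left u v)) with hu | hu <;>
    rcases eq_or_eq_of_adj_middle (hadj v (Sym2.mem_mk_right u v)) with hv | hv
  · exact absurd (hu.trans hv.symm) hne
  · rw [hu, hv]
  · rw [hu, hv, Sym2.eq_swap]
  · exact absurd (hu.trans hv.symm) hne

lemma Balanced.rung_adj_or_bend (hD : D.Balanced) (x : Fin m → ZMod 2) :
    (subdividedCube m).Adj (0, x) (1, prefixSum x) ∨
      ∃ d ∉ Set.range cubePoint, (subdividedCube m).Adj (0, x) d ∧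
        (subdividedCube m).Adj d (1, prefixSum x) ∧
        D.side (0, x) d ≠ D.side d (1, prefixSum x) := by
  have hadj : (subdividedCube m).Adj (0, x) (rungEnd (prefixSum x)) :=
    ⟨(Link.rung x).ne, .inl (.rung x)⟩
  have bit : ∀ a : ZMod 2, a = 0 ∨ a = 1 := by decide
  rcases bit (headParity (prefixSum x)) with h | h
  · rw [rungEnd, if_pos h] at hadj
    exact .inl hadj
  · rw [rungEnd, if_neg (h ▸ one_ne_zero)] at hadj
    have hadj' : (subdividedCube m).Adj (2, prefixSum x) (1, prefixSum x) :=
      ⟨(Link.bend _ h).ne, .inl (.bend _ h)⟩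
    refine .inr ⟨_, fun hmem => mem_range_cubePoint_iff.1 hmem rfl, hadj, hadj', fun hside => ?_⟩
    have heq := Finset.card_le_one.1 (hD.middle (2, prefixSum x) rfl _)
      _ (mem_sideNeighbors.2 ⟨hadj.symm, (D.side_comm _ _).trans hside⟩)
      _ (mem_sideNeighbors.2 ⟨hadj', rfl⟩)
    simp at heq

lemma Balanced.adj_or_bend {D : SpineDrawing (subdividedCube (m + 1))} (hD : D.Balanced)
    {u v : Fin (m + 2) → ZMod 2} (huv : (LTQ (m + 2)).Adj u v) :
    (subdividedCube (m + 1)).Adj (cubePoint u) (cubePoint v) ∨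
      ∃ d ∉ Set.range cubePoint, (subdividedCube (m + 1)).Adj (cubePoint u) d ∧
        (subdividedCube (m + 1)).Adj d (cubePoint v) ∧
        D.side (cubePoint u) d ≠ D.side d (cubePoint v) := by
  rcases coordsAdj_of_adj huv with ⟨hlast, i, hi⟩ | ⟨hlast, hinit⟩
  · have hlink : Link (cubePoint u) (cubePoint v) := by
      rw [cubePoint, cubePoint, ← hlast, hi]
      exact .flip _ (by split_ifs <;> decide) _ i
    exact .inl ⟨hlink.ne, .inl hlink⟩
  · have zero_or : ∀ a b : ZMod 2, a ≠ b → (a = 0 ∧ b ≠ 0) ∨ (b = 0 ∧ a ≠ 0) := by decide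
    rcases zero_or _ _ hlast with ⟨hu, hv⟩ | ⟨hv, hu⟩
    · rw [cubePoint_of_last_eq_zero hu, cubePoint_of_last_ne_zero hv, hinit]
      exact hD.rung_adj_or_bend _
    · rw [cubePoint_of_last_ne_zero hu, cubePoint_of_last_eq_zero hv, hinit]
      refine (hD.rung_adj_or_bend (Fin.init v)).imp (·.symm) fun ⟨d, hd, hvd, hdu, hside⟩ =>
        ⟨d, hd, hdu.symm, hvd.symm, fun e => hside ?_⟩
      rw [D.side_comm, ← e, D.side_comm]

theorem Balanced.realizes_LTQ {D : SpineDrawing (subdividedCube (m + 1))} (hD : D.Balanced) :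
    D.Realizes (LTQ (m + 2)) cubePoint where
  injective := cubePoint_injective
  adj_or_bend := hD.adj_or_bend
  bend_unique := by
    rintro e e' ⟨k, y⟩ he he'
    obtain rfl : k = 2 := not_not.1 fun hk => he.1 (mem_range_cubePoint_iff.2 hk)
    obtain ⟨x, rfl⟩ := Finite.injective_iff_surjective.1 prefixSum_injective y
    exact Sym2.map.injective cubePoint_injective
      ((map_eq_of_bendsAt he).trans (map_eq_of_bendsAt he').symm)

end SpineDrawing

section Bound

open scoped Finset

/-- The bound on the crossings of the drawing of `LTQ (j + 6)` that the repeated doubling gives. -/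
def crossingBound : ℕ → ℕ
  | 0 => 400
  | j + 1 => 4 * crossingBound j + (j + 5) ^ 2 / 4 * 2 ^ (j + 6) + 2 ^ (j + 4)

lemma exists_balanced_drawing (j : ℕ) : ∃ D : SpineDrawing (subdividedCube (j + 5)),
    D.Balanced ∧ #D.interleavings ≤ crossingBound j := by
  induction j with
  | zero =>
    refine ⟨FourBits.drawing.double, FourBits.balanced.double le_rfl, ?_⟩
    have hdouble := (FourBits.drawing.isDoubling_double le_rfl).card_interleavings_le
    have hcross := FourBits.card_interleavings_le
    have hwedges : #FourBits.drawing.wedges ≤ 128 := FourBits.balanced.card_wedges_le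
    have htwists := FourBits.drawing.card_twists_voltage_le
    simp only [SpineDrawing.tailParity_four, zero_ne_one, Finset.filter_false,
      Finset.card_empty] at htwists
    rw [crossingBound]
    omega
  | succ j ih =>
    obtain ⟨D, hD, hcross⟩ := ih
    refine ⟨D.double, hD.double (by omega), ?_⟩
    have hdouble := (D.isDoubling_double (by omega)).card_interleavings_le
    have hwedges : #D.wedges ≤ (j + 5) ^ 2 / 4 * 2 ^ (j + 6) := hD.card_wedges_le
    have htwists := D.card_twists_voltage_le.trans
      (SpineDrawing.card_tailParity_le (m := j + 4) (by omega))
    rw [crossingBound]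
    omega

lemma cast_sq_div_four (k : ℕ) :
    ((k ^ 2 / 4 : ℕ) : ℝ) = ((k : ℝ) ^ 2 - (1 - (-1) ^ k) / 2) / 4 := by
  rcases Nat.even_or_odd' k with ⟨l, rfl | rfl⟩
  · rw [show (2 * l) ^ 2 = 4 * l ^ 2 by ring, Nat.mul_div_cancel_left _ four_pos,
      (even_two_mul l).neg_one_pow]
    push_cast
    ring
  · rw [show (2 * l + 1) ^ 2 / 4 = l ^ 2 + l by ring_nf; omega,
      (odd_two_mul_add_one l).neg_one_pow]
    push_cast
    ring

lemma crossingBound_eq (j : ℕ) : (crossingBound j : ℝ) = 265 / 6 * 4 ^ (j + 2) -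
    (((j : ℝ) + 6) ^ 2 + (15 + (-1) ^ (j + 5)) / 6) * 2 ^ (j + 3) := by
  induction j with
  | zero => norm_num [crossingBound]
  | succ j ih =>
    have hsq := cast_sq_div_four (j + 5)
    rw [crossingBound]
    push_cast at hsq ⊢
    rw [hsq, ih]
    ring

end Bound

theorem theorem2p1 (n : ℕ) (hn : 6 ≤ n) :
    ∃ k : ℕ, crossingNumber (LTQ n) = (k : ℕ∞) ∧
      (k : ℝ) ≤ 265 / 6 * 4 ^ (n - 4) -
        ((n : ℝ) ^ 2 + (15 + (-1) ^ (n - 1)) / 6) * 2 ^ (n - 3) := by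
  obtain ⟨j, rfl⟩ := Nat.exists_eq_add_of_le' hn
  obtain ⟨D, hD, hcross⟩ := exists_balanced_drawing j
  have hle : crossingNumber (LTQ (j + 6)) ≤ crossingBound j :=
    hD.realizes_LTQ.crossingNumber_le.trans (Nat.cast_le.2 hcross)
  obtain ⟨k, hk⟩ := ENat.ne_top_iff_exists.1 (ne_top_of_le_ne_top (ENat.natCast_ne_top _) hle)
  have hkle : (k : ℝ) ≤ crossingBound j := Nat.cast_le.2 (Nat.cast_le.1 (hk ▸ hle))
  refine ⟨k, hk.symm, ?_⟩
  rw [crossingBound_eq] at hkle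
  simpa using hkle
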